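/- **Definitions.** A *form* over a category $\mathbb C$ is a faithful functor $F\colon\mathbb B\to\mathbb C$ such that the only isomorphisms of $\mathbb B$ sent to identity morphisms are the identity morphisms. Two forms $F_1,F_2$ over $\mathbb C$ are *isomorphic* if $F_1=F_2\varphi$ for an isomorphism of categories $\varphi$. Objects $A$ of $\mathbb B$ with $F(A)=X$ are called *clusters* in $X$. For $f\colon X\to Y$ and clusters $A$ in $X$, $B$ in $Y$, write $A\le_f B$ (or $B\ge_f A$) if some morphism $A\to B$ is sent to $f$. The clusters in $X$ form a poset under $\le_{1_X}$. $F$ is *orean* if the poset of clusters in each object is a bounded lattice; $A\le_{gf}C$ implies $A\le_f B\le_g C$ for some $B$; and for $f\colon X\to Y$ the direct image $f\cdot S=\min\{T\mid S\le_f T\}$ and the inverse image $T\cdot f=\max\{S\mid S\le_f T\}$ always exist. Put $\operatorname{Im}f=f\cdot\top$ and $\operatorname{Ker}f=\bot\cdot f$; a cluster is *conormal* (*normal*) if it is the image (kernel) of some morphism; an orean form is conormal (normal) if all its clusters are. An *embedding* of a conormal cluster $S$ in $X$ is a morphism $m$ with $\operatorname{Im}m=S$ through which every $f'$ into $X$ with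 $\operatorname{Im}f'\le S$ factors uniquely. Dually, a *quotient* of a normal cluster $S$ in $X$ is a morphism $e$ with $\operatorname{Ker}e=S$ through which every $g'$ out of $X$ with $\operatorname{Ker}g'\ge S$ factors uniquely. An orean form is *noetherian* if * $(f\cdot S)\cdot f=S\vee\operatorname{Ker}f$ and $f\cdot(T\cdot f)=T\wedge\operatorname{Im}f$ for all $f\colon X\to Y$ and clusters $S$ in $X$, $T$ in $Y$; * every $f$ factors as a quotient of $\operatorname{Ker}f$ followed by an embedding of $\operatorname{Im}f$; * joins of two normal clusters are normal and meets of two conormal clusters are conormal. An *operator* $F\to G$ of forms over $\mathbb C$ is a functor over $\mathbb C$; between orean forms it is *conormal* (*normal*) if it preserves images (kernels) of all morphisms, and *binormal* if both. A *subform* of $F$ is the restriction of $F$ to the full subcategory on a selection of clusters; for an idempotent operator $\kappa\colon F\to F$, $F_\kappa$ is the subform of clusters with $\kappa S=S$. An *exact meet decomposition* of an orean form $F$ is a pair $(\kappa_{\mathsf s},\kappa_{\mathsf e})$ of idempotent operators on $F$ such that $F_{\mathsf s}=F_{\kappa_{\mathsf s}}$ is a conormal orean form and $F_{\mathsf e}=F_{\kappa_{\mathsf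 e}}$ is a normal orean form, $S=\kappa_{\mathsf s}S\wedge\kappa_{\mathsf e}S$ for every cluster $S$, the restrictions $F\to F_{\mathsf s}$, $F\to F_{\mathsf e}$ of $\kappa_{\mathsf s},\kappa_{\mathsf e}$ are binormal, there are a conormal operator $F_{\mathsf s}\to F_{\mathsf e}$ and a normal operator $F_{\mathsf e}\to F_{\mathsf s}$, the inclusion $F_{\mathsf s}\to F$ is conormal, and the inclusion $F_{\mathsf e}\to F$ is normal. An *emd-noetherian form* is a noetherian form admitting an exact meet decomposition. A *bicategory structure* on $\mathbb C$ is a pair $(\mathcal E,\mathcal M)$ of classes of morphisms, called *right* and *left* morphisms. A *terminal right morphism* is a right morphism $e\colon X\to Y$ such that for every right morphism $e'\colon X\to Y'$ there is a unique $u\colon Y'\to Y$ with $ue'=e$. An *initial left morphism* is a left morphism $m\colon W\to X$ such that for every left morphism $m'\colon W'\to X$ there is a unique $u\colon W\to W'$ with $m'u=m$. An object is *right trivial* if it is the codomain of a terminal right morphism, *left trivial* if it is the domain of an initial left morphism. Consider the axioms: * (B0) $(\mathcal E,\mathcal M)$ is a factorization system with every right morphism epi and every left morphism mono; for every $X$ the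 posets of $\mathcal E$-quotients and of $\mathcal M$-subobjects of $X$ are bounded lattices; pushouts of right morphisms and pullbacks of left morphisms along arbitrary morphisms exist. * (B1) A pullback of a right morphism along a left morphism is right. Moreover, given a commutative square $bp=ea$ with $p\colon A\to A'$, $e\colon B\to B'$ right and $a\colon A\to B$, $b\colon A'\to B'$ left, and a pullback square $ek=zq$ with $k\colon K\to B$ left, $q$ right and $z$ an initial left morphism into $B'$, if $k=ah$ for some $h\colon K\to A$, then the square $bp=ea$ is a pullback. * (B2) Any pullback square $ek=zq$ with $e,q$ right, $k$ left and $z$ an initial left morphism is a pushout. * (B3) If $e'm=ne$ is a pushout square with $e\colon W\to Q$, $e'$ right and $m\colon W\to X$ left, and $z$ is an initial left morphism into $Q$, then $nz$ is a left morphism. * (B4) Every right trivial object is left trivial. * (B5) Let $ac=bd$ be a pushout square of right morphisms $c\colon Z\to X$, $d\colon Z\to Y$, $a\colon X\to W$, $b\colon Y\to W$, and let $ck=zq$ and $bk'=z'q'$ be pullback squares with $q,q'$ right, $k,k'$ left and $z,z'$ initial left morphisms. If $t$ is a morphism with $k't=dk$, then $t$ is right. The *form of subquotients* of $(\mathcal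 E,\mathcal M)$ has as clusters in $X$ the classes $[e,m]$ of pairs consisting of a right morphism $e$ and a left morphism $m$ with common domain, $m$ having codomain $X$. For $f\colon X\to Y$, $[e,m]\le_f[e',m']$ if and only if $m'u=fm$ and $e'u=se$ for some $u,s$; two pairs are identified when each is $\le_{1_X}$ the other. **Theorem.** Let $\mathbb C$ be a category. There is a bijection between isomorphism classes of emd-noetherian forms over $\mathbb C$ and bicategory structures $(\mathcal E,\mathcal M)$ on $\mathbb C$ satisfying (B0)–(B5), under which the structure corresponding to an emd-noetherian form $F$ has as right morphisms exactly the quotients (of normal clusters) for $F$ and as left morphisms exactly the embeddings (of conormal clusters) for $F$. Moreover, for a bicategory structure satisfying (B0)–(B5), the subform of its form of subquotients consisting of those $[e,m]$ for which the pushout of $m$ along $e$ is an initial left morphism is an emd-noetherian form, and its isomorphism class corresponds to the given bicategory structure. -/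

import Mathlib

open CategoryTheory

universe v u

namespace FormTheory

/-! ### Forms -/

/-- A form over `C`: a faithful amnestic functor into `C`. -/
structure Form (C : Type u) [Category.{v} C] where
  Carrier : Type (max u v)
  [category : Category.{v} Carrier]
  proj : Carrier ⥤ C
  faithful : proj.Faithful
  /-- An isomorphism lying over an identity morphism is an identity morphism. -/
  amnestic : ∀ {A B : Carrier} (i : A ≅ B) (h : proj.obj A = proj.obj B),
    proj.map i.hom = eqToHom h → ∃ h' : A = B, i.hom = eqToHom h'

attribute [instance] Form.category Form.faithful

/-- A cluster system over `C`: sets of clusters and relations `A ≤_f B`, reflexive,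
transitive and antisymmetric in the sense below. -/
structure ClusterSystem (C : Type u) [Category.{v} C] where
  Cluster : C → Type (max u v)
  rel : ∀ {X Y : C}, (X ⟶ Y) → Cluster X → Cluster Y → Prop
  refl : ∀ {X : C} (A : Cluster X), rel (𝟙 X) A A
  trans : ∀ {X Y Z : C} (f : X ⟶ Y) (g : Y ⟶ Z) (A : Cluster X) (B : Cluster Y) (D : Cluster Z),
    rel f A B → rel g B D → rel (f ≫ g) A D
  antisymm : ∀ {X : C} (A B : Cluster X), rel (𝟙 X) A B → rel (𝟙 X) B A → A = B

/-- A bounded lattice, as a property of a poset. -/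
structure IsBoundedLattice (P : Type*) [PartialOrder P] : Prop where
  exists_top : ∃ a : P, IsTop a
  exists_bot : ∃ a : P, IsBot a
  exists_sup : ∀ a b : P, ∃ c, IsLUB {a, b} c
  exists_inf : ∀ a b : P, ∃ c, IsGLB {a, b} c

namespace ClusterSystem

variable {C : Type u} [Category.{v} C]

structure Obj (K : ClusterSystem C) : Type (max u v) where
  base : C
  cluster : K.Cluster base

structure Hom (K : ClusterSystem C) (P Q : K.Obj) : Type v where
  hom : P.base ⟶ Q.base
  rel : K.rel hom P.cluster Q.cluster

theorem Hom.ext' {K : ClusterSystem C} {P Q : K.Obj} {f g : K.Hom P Q} (h : f.hom = g.hom) :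
    f = g := by
  cases f; cases g; cases h; rfl

instance (K : ClusterSystem C) : Category.{v} K.Obj where
  Hom P Q := K.Hom P Q
  id P := ⟨𝟙 P.base, K.refl P.cluster⟩
  comp f g := ⟨f.hom ≫ g.hom, K.trans _ _ _ _ _ f.rel g.rel⟩
  id_comp f := Hom.ext' (Category.id_comp f.hom)
  comp_id f := Hom.ext' (Category.comp_id f.hom)
  assoc f g h := Hom.ext' (Category.assoc f.hom g.hom h.hom)

/-- The projection of a cluster system onto its base category. -/
def objProj (K : ClusterSystem C) : K.Obj ⥤ C where
  obj P := P.base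
  map f := f.hom

/-- The form presented by a cluster system. -/
def toForm (K : ClusterSystem C) : Form C where
  Carrier := K.Obj
  proj := K.objProj
  faithful := ⟨fun h => Hom.ext' h⟩
  amnestic := by
    rintro ⟨X, A⟩ ⟨Y, B⟩ i h hi
    obtain rfl : X = Y := h
    have h₁ : i.hom.hom = 𝟙 X := hi
    have h₂ : i.inv.hom = 𝟙 X := by
      have h₃ : i.hom.hom ≫ i.inv.hom = 𝟙 X := congrArg Hom.hom i.hom_inv_id
      rwa [h₁, Category.id_comp] at h₃
    have r₁ : K.rel (𝟙 X) A B := h₁ ▸ i.hom.rel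
    have r₂ : K.rel (𝟙 X) B A := h₂ ▸ i.inv.rel
    obtain rfl := K.antisymm A B r₁ r₂
    exact ⟨rfl, Hom.ext' h₁⟩

end ClusterSystem

namespace Form

variable {C : Type u} [Category.{v} C]

/-- The clusters of a form in an object `X`. -/
def Cluster (F : Form C) (X : C) : Type (max u v) := {A : F.Carrier // F.proj.obj A = X}

/-- `F.Rel f A B` is the relation `A ≤_f B`: some morphism `A ⟶ B` lies over `f`. -/
def Rel (F : Form C) {X Y : C} (f : X ⟶ Y) (A : F.Cluster X) (B : F.Cluster Y) : Prop :=
  ∃ φ : A.1 ⟶ B.1, F.proj.map φ = eqToHom A.2 ≫ f ≫ eqToHom B.2.symm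

/-- The clusters in a fixed object are ordered by the relation over the identity morphism. -/
instance (F : Form C) (X : C) : PartialOrder (F.Cluster X) where
  le A B := F.Rel (𝟙 X) A B
  le_refl A := ⟨𝟙 _, by simp⟩
  le_trans A B D := by
    rintro ⟨φ, hφ⟩ ⟨ψ, hψ⟩
    exact ⟨φ ≫ ψ, by simp [hφ, hψ]⟩
  le_antisymm := by
    rintro ⟨A, rfl⟩ ⟨B, hB⟩ ⟨φ, hφ⟩ ⟨ψ, hψ⟩
    refine Subtype.ext ?_
    exact (F.amnestic
      ⟨φ, ψ, F.proj.map_injective (by simp [hφ, hψ]), F.proj.map_injective (by simp [hφ, hψ])⟩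
      hB.symm (by simp [hφ])).1

/-- Two forms over `C` are isomorphic when there is an isomorphism of categories over `C`. -/
def IsIsomorphic (F G : Form C) : Prop :=
  ∃ (φ : F.Carrier ⥤ G.Carrier) (ψ : G.Carrier ⥤ F.Carrier),
    φ ⋙ ψ = 𝟭 F.Carrier ∧ ψ ⋙ φ = 𝟭 G.Carrier ∧ φ ⋙ G.proj = F.proj

theorem IsIsomorphic.refl (F : Form C) : F.IsIsomorphic F := ⟨𝟭 _, 𝟭 _, rfl, rfl, rfl⟩

theorem IsIsomorphic.symm {F G : Form C} : F.IsIsomorphic G → G.IsIsomorphic F := by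
  rintro ⟨φ, ψ, h₁, h₂, h₃⟩
  refine ⟨ψ, φ, h₂, h₁, ?_⟩
  rw [← h₃, ← Functor.assoc, h₂, Functor.id_comp]

theorem IsIsomorphic.trans {F G H : Form C} :
    F.IsIsomorphic G → G.IsIsomorphic H → F.IsIsomorphic H := by
  rintro ⟨φ, ψ, h₁, h₂, h₃⟩ ⟨φ', ψ', h₁', h₂', h₃'⟩
  refine ⟨φ ⋙ φ', ψ' ⋙ ψ, ?_, ?_, ?_⟩
  · rw [Functor.assoc, ← Functor.assoc φ', h₁', Functor.id_comp, h₁]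
  · rw [Functor.assoc, ← Functor.assoc ψ, h₂, Functor.id_comp, h₂']
  · rw [Functor.assoc, h₃', h₃]

/-- The subform of `F` given by a selection of clusters. -/
def subform (F : Form C) (P : ObjectProperty F.Carrier) : Form C where
  Carrier := P.FullSubcategory
  proj := P.ι ⋙ F.proj
  faithful := inferInstance
  amnestic := by
    rintro ⟨A, hA⟩ ⟨B, hB⟩ i h hi
    obtain ⟨h', e⟩ := F.amnestic (P.ι.mapIso i) h hi
    obtain rfl : A = B := h'
    exact ⟨rfl, ObjectProperty.hom_ext P e⟩

/-! ### Orean and noetherian forms -/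

/-- An orean form: its posets of clusters are bounded lattices, the relations `A ≤_f B` compose
exactly along composites, and direct and inverse images of clusters exist. -/
class IsOrean (F : Form C) : Prop where
  isBoundedLattice : ∀ X : C, IsBoundedLattice (F.Cluster X)
  exists_of_rel_comp : ∀ {X Y Z : C} (f : X ⟶ Y) (g : Y ⟶ Z) (A : F.Cluster X) (D : F.Cluster Z),
    F.Rel (f ≫ g) A D → ∃ B : F.Cluster Y, F.Rel f A B ∧ F.Rel g B D
  exists_dir : ∀ {X Y : C} (f : X ⟶ Y) (S : F.Cluster X), ∃ T, IsLeast {T | F.Rel f S T} T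
  exists_inv : ∀ {X Y : C} (f : X ⟶ Y) (T : F.Cluster Y), ∃ S, IsGreatest {S | F.Rel f S T} S

noncomputable instance (F : Form C) [F.IsOrean] (X : C) : Lattice (F.Cluster X) where
  __ := (inferInstance : PartialOrder (F.Cluster X))
  sup A B := ((IsOrean.isBoundedLattice (F := F) X).exists_sup A B).choose
  inf A B := ((IsOrean.isBoundedLattice (F := F) X).exists_inf A B).choose
  le_sup_left A B :=
    ((IsOrean.isBoundedLattice (F := F) X).exists_sup A B).choose_spec.1 (by simp)
  le_sup_right A B :=
    ((IsOrean.isBoundedLattice (F := F) X).exists_sup A B).choose_spec.1 (by simp)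
  sup_le A B D hA hB :=
    ((IsOrean.isBoundedLattice (F := F) X).exists_sup A B).choose_spec.2
      (by rintro _ (rfl | rfl) <;> assumption)
  inf_le_left A B :=
    ((IsOrean.isBoundedLattice (F := F) X).exists_inf A B).choose_spec.1 (by simp)
  inf_le_right A B :=
    ((IsOrean.isBoundedLattice (F := F) X).exists_inf A B).choose_spec.1 (by simp)
  le_inf D A B hA hB :=
    ((IsOrean.isBoundedLattice (F := F) X).exists_inf A B).choose_spec.2
      (by rintro _ (rfl | rfl) <;> assumption)

noncomputable instance (F : Form C) [F.IsOrean] (X : C) : BoundedOrder (F.Cluster X) where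
  top := (IsOrean.isBoundedLattice (F := F) X).exists_top.choose
  le_top := (IsOrean.isBoundedLattice (F := F) X).exists_top.choose_spec
  bot := (IsOrean.isBoundedLattice (F := F) X).exists_bot.choose
  bot_le := (IsOrean.isBoundedLattice (F := F) X).exists_bot.choose_spec

section Orean

variable (F : Form C) [F.IsOrean] {X Y : C}

/-- The direct image `f · S`. -/
noncomputable def dir (f : X ⟶ Y) (S : F.Cluster X) : F.Cluster Y :=
  (IsOrean.exists_dir (F := F) f S).choose

/-- The inverse image `T · f`. -/
noncomputable def inv (f : X ⟶ Y) (T : F.Cluster Y) : F.Cluster X :=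
  (IsOrean.exists_inv (F := F) f T).choose

/-- The image of a morphism. -/
noncomputable def im (f : X ⟶ Y) : F.Cluster Y := F.dir f ⊤

/-- The kernel of a morphism. -/
noncomputable def ker (f : X ⟶ Y) : F.Cluster X := F.inv f ⊥

/-- A cluster that is the image of some morphism. -/
def ConormalCluster (S : F.Cluster X) : Prop := ∃ (W : C) (f : W ⟶ X), F.im f = S

/-- A cluster that is the kernel of some morphism. -/
def NormalCluster (S : F.Cluster X) : Prop := ∃ (W : C) (g : X ⟶ W), F.ker g = S

/-- `f` is an embedding of the cluster `S`. -/
def IsEmbeddingOf (f : Y ⟶ X) (S : F.Cluster X) : Prop :=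
  F.im f = S ∧ ∀ ⦃W : C⦄ (f' : W ⟶ X), F.im f' ≤ S → ∃! g : W ⟶ Y, g ≫ f = f'

/-- `g` is a quotient of the cluster `S`. -/
def IsQuotientOf (g : X ⟶ Y) (S : F.Cluster X) : Prop :=
  F.ker g = S ∧ ∀ ⦃W : C⦄ (g' : X ⟶ W), S ≤ F.ker g' → ∃! h : Y ⟶ W, g ≫ h = g'

/-- The class of `F`-embeddings, i.e. of embeddings of conormal clusters. -/
def embeddings : MorphismProperty C :=
  fun _ X f => ∃ S : F.Cluster X, F.ConormalCluster S ∧ F.IsEmbeddingOf f S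

/-- The class of `F`-quotients, i.e. of quotients of normal clusters. -/
def quotients : MorphismProperty C :=
  fun X _ g => ∃ S : F.Cluster X, F.NormalCluster S ∧ F.IsQuotientOf g S

end Orean

/-- A conormal form: an orean form in which every cluster is conormal. -/
class IsConormalForm (F : Form C) : Prop extends F.IsOrean where
  conormal : ∀ {X : C} (S : F.Cluster X), F.ConormalCluster S

/-- A normal form: an orean form in which every cluster is normal. -/
class IsNormalForm (F : Form C) : Prop extends F.IsOrean where
  normal : ∀ {X : C} (S : F.Cluster X), F.NormalCluster S

/-- A noetherian form: an orean form with the axioms below. -/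
class IsNoetherian (F : Form C) : Prop extends F.IsOrean where
  inv_dir : ∀ {X Y : C} (f : X ⟶ Y) (S : F.Cluster X), F.inv f (F.dir f S) = S ⊔ F.ker f
  dir_inv : ∀ {X Y : C} (f : X ⟶ Y) (T : F.Cluster Y), F.dir f (F.inv f T) = T ⊓ F.im f
  factorization : ∀ {X Y : C} (f : X ⟶ Y), ∃ (W : C) (e : X ⟶ W) (m : W ⟶ Y),
    F.IsQuotientOf e (F.ker f) ∧ F.IsEmbeddingOf m (F.im f) ∧ e ≫ m = f
  normal_sup : ∀ {X : C} (S T : F.Cluster X),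
    F.NormalCluster S → F.NormalCluster T → F.NormalCluster (S ⊔ T)
  conormal_inf : ∀ {X : C} (S T : F.Cluster X),
    F.ConormalCluster S → F.ConormalCluster T → F.ConormalCluster (S ⊓ T)

end Form

/-! ### Operators and exact meet decompositions -/

/-- An operator between forms over the same category: a functor over that category. -/
structure Operator {C : Type u} [Category.{v} C] (F G : Form C) where
  functor : F.Carrier ⥤ G.Carrier
  comm : functor ⋙ G.proj = F.proj

namespace Operator

variable {C : Type u} [Category.{v} C] {F G : Form C}

/-- The action of an operator on clusters. -/
def app (τ : Operator F G) {X : C} (A : F.Cluster X) : G.Cluster X :=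
  ⟨τ.functor.obj A.1, (Functor.congr_obj τ.comm A.1).trans A.2⟩

/-- A conormal operator preserves images. -/
def IsConormal (τ : Operator F G) [F.IsOrean] [G.IsOrean] : Prop :=
  ∀ {X Y : C} (f : X ⟶ Y), τ.app (F.im f) = G.im f

/-- A normal operator preserves kernels. -/
def IsNormal (τ : Operator F G) [F.IsOrean] [G.IsOrean] : Prop :=
  ∀ {X Y : C} (f : X ⟶ Y), τ.app (F.ker f) = G.ker f

/-- Idempotent operators. -/
def IsIdempotent (κ : Operator F F) : Prop := κ.functor ⋙ κ.functor = κ.functor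

/-- The property of being a `κ`-closed cluster. -/
def closedProp (κ : Operator F F) : ObjectProperty F.Carrier := fun A => κ.functor.obj A = A

/-- The subform of `κ`-closed clusters. -/
def closed (κ : Operator F F) : Form C := F.subform κ.closedProp

/-- The inclusion of the subform of `κ`-closed clusters. -/
def inclusion (κ : Operator F F) : Operator κ.closed F where
  functor := κ.closedProp.ι
  comm := rfl

/-- An idempotent operator, viewed as an operator into the subform of its closed clusters. -/
def restriction (κ : Operator F F) (h : κ.IsIdempotent) : Operator F κ.closed where
  functor := κ.closedProp.lift κ.functor (fun A => Functor.congr_obj h A)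
  comm := κ.comm

end Operator

/-- A semiexact pair of forms. -/
def IsSemiexactPair {C : Type u} [Category.{v} C] (F G : Form C)
    [F.IsConormalForm] [G.IsNormalForm] : Prop :=
  (∃ α : Operator F G, α.IsConormal) ∧ (∃ β : Operator G F, β.IsNormal)

/-- `(κs, κe)` is an exact decomposition of `F` whose decomposing term is the binary meet. -/
structure IsExactMeetDecomposition {C : Type u} [Category.{v} C] {F : Form C} [F.IsOrean]
    (κs κe : Operator F F) : Prop where
  idem_s : κs.IsIdempotent
  idem_e : κe.IsIdempotent
  [conormalForm_s : κs.closed.IsConormalForm]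
  [normalForm_e : κe.closed.IsNormalForm]
  eq_inf : ∀ {X : C} (S : F.Cluster X), S = κs.app S ⊓ κe.app S
  proj_s_conormal : (κs.restriction idem_s).IsConormal
  proj_s_normal : (κs.restriction idem_s).IsNormal
  proj_e_conormal : (κe.restriction idem_e).IsConormal
  proj_e_normal : (κe.restriction idem_e).IsNormal
  semiexact : IsSemiexactPair κs.closed κe.closed
  incl_s_conormal : κs.inclusion.IsConormal
  incl_e_normal : κe.inclusion.IsNormal

/-- An emd-noetherian form: a noetherian form admitting an exact meet decomposition. -/
class IsEmdNoetherian {C : Type u} [Category.{v} C] (F : Form C) : Prop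
    extends F.IsNoetherian where
  exists_decomposition : ∃ κs κe : Operator F F, IsExactMeetDecomposition κs κe

/-- The emd-noetherian forms over a category. -/
structure EmdForm (C : Type u) [Category.{v} C] where
  form : Form C
  [emd : IsEmdNoetherian form]

attribute [instance] EmdForm.emd

/-- Isomorphism of emd-noetherian forms. -/
instance EmdForm.setoid (C : Type u) [Category.{v} C] : Setoid (EmdForm C) where
  r F G := F.form.IsIsomorphic G.form
  iseqv := ⟨fun F => .refl F.form, .symm, .trans⟩

/-! ### Bicategory structures -/

/-- A bicategory structure on `C`: a class of right morphisms and a class of left morphisms. -/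
structure BicategoryStructure (C : Type u) [Category.{v} C] where
  right : MorphismProperty C
  left : MorphismProperty C

namespace BicategoryStructure

variable {C : Type u} [Category.{v} C] (S : BicategoryStructure C)

/-- A terminal right morphism out of `X`. -/
def IsTerminalRight {X Y : C} (e : X ⟶ Y) : Prop :=
  S.right e ∧ ∀ ⦃Y' : C⦄ (e' : X ⟶ Y'), S.right e' → ∃! w : Y' ⟶ Y, e' ≫ w = e

/-- An initial left morphism into `X`. -/
def IsInitialLeft {W X : C} (m : W ⟶ X) : Prop :=
  S.left m ∧ ∀ ⦃W' : C⦄ (m' : W' ⟶ X), S.left m' → ∃! w : W ⟶ W', w ≫ m' = m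

/-- A left trivial object: the domain of an initial left morphism. -/
def LeftTrivial (W : C) : Prop := ∃ (X : C) (m : W ⟶ X), S.IsInitialLeft m

/-- A right trivial object: the codomain of a terminal right morphism. -/
def RightTrivial (Y : C) : Prop := ∃ (X : C) (e : X ⟶ Y), S.IsTerminalRight e

/-- The right and left morphisms form a proper factorization system. -/
structure IsProperFactorizationSystem : Prop where
  right_of_isIso : ∀ {X Y : C} (f : X ⟶ Y) [IsIso f], S.right f
  left_of_isIso : ∀ {X Y : C} (f : X ⟶ Y) [IsIso f], S.left f
  right_comp : ∀ {X Y Z : C} (f : X ⟶ Y) (g : Y ⟶ Z), S.right f → S.right g → S.right (f ≫ g)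
  left_comp : ∀ {X Y Z : C} (f : X ⟶ Y) (g : Y ⟶ Z), S.left f → S.left g → S.left (f ≫ g)
  factorization : ∀ {X Y : C} (f : X ⟶ Y), ∃ (W : C) (e : X ⟶ W) (m : W ⟶ Y),
    S.right e ∧ S.left m ∧ e ≫ m = f
  diagonal : ∀ {X Y Z W : C} (e : X ⟶ Y) (f : Y ⟶ W) (g : X ⟶ Z) (m : Z ⟶ W),
    S.right e → S.left m → e ≫ f = g ≫ m → ∃! d : Y ⟶ Z, e ≫ d = g ∧ d ≫ m = f
  epi_of_right : ∀ {X Y : C} (f : X ⟶ Y), S.right f → Epi f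
  mono_of_left : ∀ {X Y : C} (f : X ⟶ Y), S.left f → Mono f

/-- A left morphism into `X`, representing a subobject of `X`. -/
structure LeftOver (X : C) where
  dom : C
  hom : dom ⟶ X
  prop : S.left hom

/-- A right morphism out of `X`, representing a quotient of `X`. -/
structure RightUnder (X : C) where
  cod : C
  hom : X ⟶ cod
  prop : S.right hom

variable {S} in
instance (X : C) : Preorder (S.LeftOver X) where
  le m m' := ∃ w : m.dom ⟶ m'.dom, w ≫ m'.hom = m.hom
  le_refl m := ⟨𝟙 _, Category.id_comp _⟩
  le_trans := by
    rintro m m' m'' ⟨w, hw⟩ ⟨w', hw'⟩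
    exact ⟨w ≫ w', by rw [Category.assoc, hw', hw]⟩

variable {S} in
instance (X : C) : Preorder (S.RightUnder X) where
  le e e' := ∃ w : e.cod ⟶ e'.cod, e.hom ≫ w = e'.hom
  le_refl e := ⟨𝟙 _, Category.comp_id _⟩
  le_trans := by
    rintro e e' e'' ⟨w, hw⟩ ⟨w', hw'⟩
    exact ⟨w ≫ w', by rw [← Category.assoc, hw, hw']⟩

/-- The poset of subobjects of `X`. -/
abbrev Subobjects (X : C) := Antisymmetrization (S.LeftOver X) (· ≤ ·)

/-- The poset of quotients of `X`. -/
abbrev Quotients (X : C) := Antisymmetrization (S.RightUnder X) (· ≤ ·)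

structure B0 : Prop where
  properFactorizationSystem : S.IsProperFactorizationSystem
  subobjects : ∀ X : C, IsBoundedLattice (S.Subobjects X)
  quotients : ∀ X : C, IsBoundedLattice (S.Quotients X)
  hasPushout : ∀ {X Y Z : C} (e : X ⟶ Y) (f : X ⟶ Z), S.right e → Limits.HasPushout e f
  hasPullback : ∀ {X Y Z : C} (m : X ⟶ Z) (f : Y ⟶ Z), S.left m → Limits.HasPullback m f

/-- Right morphisms are stable under pullback along left morphisms; and a commutative square
with horizontal right morphisms `p`, `e` and vertical left morphisms `a`, `b` is a pullback if the
pullback `k` along `e` of an initial left morphism `z` factors through `a`. -/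
structure B1 : Prop where
  pullback_right : ∀ {P X Y Z : C} (e' : P ⟶ X) (m' : P ⟶ Y) (m : X ⟶ Z) (e : Y ⟶ Z),
    S.left m → S.right e → IsPullback e' m' m e → S.right e'
  isPullback : ∀ {A A' B B' K O : C} (p : A ⟶ A') (a : A ⟶ B) (b : A' ⟶ B') (e : B ⟶ B')
    (k : K ⟶ B) (q : K ⟶ O) (z : O ⟶ B') (h : K ⟶ A),
    S.right p → S.left a → S.left b → S.right e → S.left k → S.right q → S.IsInitialLeft z →
    p ≫ b = a ≫ e → h ≫ a = k → IsPullback q k z e → IsPullback p a b e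

/-- A pullback of a right morphism `e` and an initial left morphism `z`, with opposite sides
again right and left respectively, is a pushout. -/
def B2 : Prop :=
  ∀ {K O X Y : C} (q : K ⟶ O) (k : K ⟶ X) (z : O ⟶ Y) (e : X ⟶ Y),
    S.right q → S.left k → S.IsInitialLeft z → S.right e → IsPullback q k z e → IsPushout q k z e

/-- If `n` is the pushout of a left morphism `m` along a right morphism `e`, then
the composite of `n` with an initial left morphism is a left morphism. -/
def B3 : Prop :=
  ∀ {O W X Q P : C} (z : O ⟶ Q) (e : W ⟶ Q) (m : W ⟶ X) (n : Q ⟶ P) (e' : X ⟶ P),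
    S.IsInitialLeft z → S.right e → S.left m → S.right e' → IsPushout e m n e' → S.left (z ≫ n)

/-- Every right trivial object is left trivial. -/
def B4 : Prop := ∀ X : C, S.RightTrivial X → S.LeftTrivial X

/-- Given a pushout `c ≫ a = d ≫ b` of right morphisms, let `k` and `k'` be the pullbacks along
`c` and `b` of initial left morphisms. Then the morphism `t` induced by `d` between the
domains of `k` and `k'` is a right morphism. -/
def B5 : Prop :=
  ∀ {K K' O O' X Y Z W : C} (q : K ⟶ O) (k : K ⟶ Z) (z : O ⟶ X) (c : Z ⟶ X)
    (q' : K' ⟶ O') (k' : K' ⟶ Y) (z' : O' ⟶ W) (b : Y ⟶ W)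
    (d : Z ⟶ Y) (a : X ⟶ W) (t : K ⟶ K'),
    S.right q → S.left k → S.IsInitialLeft z → S.right c →
    S.right q' → S.left k' → S.IsInitialLeft z' → S.right b → S.right d → S.right a →
    IsPullback q k z c → IsPullback q' k' z' b → IsPushout c d a b → t ≫ k' = k ≫ d → S.right t

/-- The conjunction of (B0)-(B5). -/
structure Axioms : Prop where
  b0 : S.B0
  b1 : S.B1
  b2 : S.B2
  b3 : S.B3
  b4 : S.B4
  b5 : S.B5

/-! ### Subquotients -/

/-- A pair `(e, m)` of a right and a left morphism with the same domain, with `m` into `X`. -/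
structure Span (X : C) where
  dom : C
  cod : C
  e : dom ⟶ cod
  m : dom ⟶ X
  right_e : S.right e
  left_m : S.left m

variable {S} in
/-- The relation `[e, m] ≤_f [e', m']` on representatives. -/
def Span.Rel {X Y : C} (f : X ⟶ Y) (p : S.Span X) (p' : S.Span Y) : Prop :=
  ∃ (w : p.dom ⟶ p'.dom) (s : p.cod ⟶ p'.cod), w ≫ p'.m = p.m ≫ f ∧ w ≫ p'.e = p.e ≫ s

variable {S} in
theorem Span.Rel.refl {X : C} (p : S.Span X) : p.Rel (𝟙 X) p := ⟨𝟙 _, 𝟙 _, by simp, by simp⟩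

variable {S} in
theorem Span.Rel.trans {X Y Z : C} {f : X ⟶ Y} {g : Y ⟶ Z} {p : S.Span X} {p' : S.Span Y}
    {p'' : S.Span Z} : p.Rel f p' → p'.Rel g p'' → p.Rel (f ≫ g) p'' := by
  rintro ⟨w, s, h₁, h₂⟩ ⟨w', s', h₁', h₂'⟩
  exact ⟨w ≫ w', s ≫ s', by rw [Category.assoc, h₁', ← Category.assoc, h₁, Category.assoc],
    by rw [Category.assoc, h₂', ← Category.assoc, h₂, Category.assoc]⟩

variable {S} in
theorem Span.Rel.comp_id {X Y : C} {f : X ⟶ Y} {p p' : S.Span X} {r r' : S.Span Y}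
    (h : p'.Rel (𝟙 X) p) (hf : p.Rel f r) (h' : r.Rel (𝟙 Y) r') : p'.Rel f r' := by
  have := (h.trans hf).trans h'
  simpa using this

/-- Two pairs represent the same subquotient when each is below the other. -/
instance spanSetoid (X : C) : Setoid (S.Span X) where
  r p p' := p.Rel (𝟙 X) p' ∧ p'.Rel (𝟙 X) p
  iseqv :=
    { refl := fun p => ⟨.refl p, .refl p⟩
      symm := fun h => ⟨h.2, h.1⟩
      trans := fun {p _ r} h h' =>
        ⟨Span.Rel.comp_id h.1 h'.1 (.refl r), Span.Rel.comp_id h'.2 h.2 (.refl p)⟩ }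

/-- The subquotients of `X`. -/
def Subquotient (X : C) : Type (max u v) := Quotient (S.spanSetoid X)

/-- The cluster system of subquotients. -/
def subquotientSystem : ClusterSystem C where
  Cluster X := S.Subquotient X
  rel f := Quotient.lift₂ (fun p p' => p.Rel f p') (fun _ _ _ _ h h' => propext
    ⟨fun r => Span.Rel.comp_id h.2 r h'.1, fun r => Span.Rel.comp_id h.1 r h'.2⟩)
  refl := by
    rintro X ⟨p⟩
    exact Span.Rel.refl p
  trans := by
    rintro X Y Z f g ⟨p⟩ ⟨p'⟩ ⟨p''⟩ h h'
    exact Span.Rel.trans h h'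
  antisymm := by
    rintro X ⟨p⟩ ⟨p'⟩ h h'
    exact Quotient.sound ⟨h, h'⟩

/-- The form of subquotients. -/
def subquotientForm : Form C := S.subquotientSystem.toForm

/-- The subform of those subquotients `[e, m]` for which the pushout `n` of `m` along `e` is an
initial left morphism. -/
def emdSubform : Form C :=
  S.subquotientForm.subform fun A : S.subquotientSystem.Obj =>
    ∃ p : S.Span A.base, (Quotient.mk _ p : S.Subquotient A.base) = A.cluster ∧
      ∃ (P : C) (n : p.cod ⟶ P) (e' : A.base ⟶ P), IsPushout p.e p.m n e' ∧ S.IsInitialLeft n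

end BicategoryStructure

end FormTheory

open FormTheory

namespace FormTheory

/-! In a noetherian form the embeddings are the morphisms with kernel `⊥` and the quotients those
with image `⊤` (`embeddings_iff`, `quotients_iff`). An exact meet decomposition amounts to two
closure operators: `κs`, onto the conormal clusters, and `κe`, onto the normal ones, such that `A =
κs A ⊓ κe A` and `κs (ker f)` is the inverse image of `κs ⊥` (`IsClosurePair`). Subobjects are then
the `κs`-closed clusters and quotient objects the `κe`-closed ones. The initial left morphism embeds
`κs ⊥`, and its pullback along `e` embeds `κs (ker e)`. Under this dictionary (B1)-(B5) become
lattice statements: (B1) and (B2) come from the identities relating direct and inverse images, (B3)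
from the meet decomposition, (B4) from normality of `⊤`, and (B5) from normality of joins of normal
clusters.

The structure determines the form. Let `m` embed `κs A` and let `e` be the quotient by the inverse
image of `A` along `m`. Then `A = m · Ker e`, the codomain of `e` is left trivial, and the relations
between clusters are those between the spans `[e, m]`. So the form is presented by its own structure
(`IsClosurePair.presents`), and two forms presented by one structure are isomorphic
(`Presents.isIsomorphic`).

Conversely, given (B0)-(B5), the subform in the theorem selects exactly the spans whose right leg
has left trivial codomain, so it too is presented by the structure. Replacing `[e, m]` by the
subobject `A` of `m` and the direct image `E` of `e` along `m` identifies clusters with admissible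
pairs: `A` lies in the kernel of `E`, and `E` is the pushforward of its own restriction to `A`. The
order is componentwise. Joins and direct images are componentwise too, while meets and inverse
images need a coreflection of the second component. The axioms, now equations between lattice
operations (`sinv_sdir_of_right`, `coreflect_kerSub`, `qinv_qdir_of_left`, `kerSub_top`,
`kerSub_sup`), give the noetherian identities. The closures are `(A, E) ↦ (A, coreflect A ⊤)` and
`(A, E) ↦ (kerSub E, E)`. The quotients and embeddings of the resulting form are the original
classes (`PairPresentation.bicategoryStructure_eq`). -/

theorem IsBoundedLattice.of_surjective {P Q : Type*} [PartialOrder P] [PartialOrder Q]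
    (h : IsBoundedLattice P) (φ : P → Q) (hφ : ∀ a b, φ a ≤ φ b ↔ a ≤ b)
    (hs : Function.Surjective φ) : IsBoundedLattice Q where
  exists_top := by
    obtain ⟨t, ht⟩ := h.exists_top
    refine ⟨φ t, fun q => ?_⟩
    obtain ⟨a, rfl⟩ := hs q
    exact (hφ _ _).2 (ht a)
  exists_bot := by
    obtain ⟨t, ht⟩ := h.exists_bot
    refine ⟨φ t, fun q => ?_⟩
    obtain ⟨a, rfl⟩ := hs q
    exact (hφ _ _).2 (ht a)
  exists_sup := by
    intro p q
    obtain ⟨a, rfl⟩ := hs p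
    obtain ⟨b, rfl⟩ := hs q
    obtain ⟨c, hc⟩ := h.exists_sup a b
    refine ⟨φ c, ?_, ?_⟩
    · rintro _ (rfl | rfl)
      exacts [(hφ _ _).2 (hc.1 (by simp)), (hφ _ _).2 (hc.1 (by simp))]
    · intro r hr
      obtain ⟨d, rfl⟩ := hs r
      refine (hφ _ _).2 (hc.2 ?_)
      rintro _ (rfl | rfl)
      exacts [(hφ _ _).1 (hr (by simp)), (hφ _ _).1 (hr (by simp))]
  exists_inf := by
    intro p q
    obtain ⟨a, rfl⟩ := hs p
    obtain ⟨b, rfl⟩ := hs q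
    obtain ⟨c, hc⟩ := h.exists_inf a b
    refine ⟨φ c, ?_, ?_⟩
    · rintro _ (rfl | rfl)
      exacts [(hφ _ _).2 (hc.1 (by simp)), (hφ _ _).2 (hc.1 (by simp))]
    · intro r hr
      obtain ⟨d, rfl⟩ := hs r
      refine (hφ _ _).2 (hc.2 ?_)
      rintro _ (rfl | rfl)
      exacts [(hφ _ _).1 (hr (by simp)), (hφ _ _).1 (hr (by simp))]

/-! ### Clusters, images and kernels in a form -/

namespace Form

variable {C : Type u} [Category.{v} C] {F : Form C} {X Y Z W : C}

theorem le_iff_rel {A B : F.Cluster X} : A ≤ B ↔ F.Rel (𝟙 X) A B := Iff.rfl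

theorem Rel.comp {f : X ⟶ Y} {g : Y ⟶ Z} {A : F.Cluster X} {B : F.Cluster Y} {D : F.Cluster Z} :
    F.Rel f A B → F.Rel g B D → F.Rel (f ≫ g) A D := by
  rintro ⟨φ, hφ⟩ ⟨ψ, hψ⟩
  exact ⟨φ ≫ ψ, by simp [hφ, hψ]⟩

theorem Rel.of_le_left {f : X ⟶ Y} {A A' : F.Cluster X} {B : F.Cluster Y}
    (h : A ≤ A') (h' : F.Rel f A' B) : F.Rel f A B := by
  simpa using Rel.comp (le_iff_rel.1 h) h'

theorem Rel.of_le_right {f : X ⟶ Y} {A : F.Cluster X} {B B' : F.Cluster Y}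
    (h : F.Rel f A B) (h' : B ≤ B') : F.Rel f A B' := by
  simpa using Rel.comp h (le_iff_rel.1 h')

/-- An object of the domain of a form, as a cluster. -/
def toCluster (F : Form C) (A : F.Carrier) : F.Cluster (F.proj.obj A) := ⟨A, rfl⟩

theorem rel_map {A B : F.Carrier} (φ : A ⟶ B) :
    F.Rel (F.proj.map φ) (F.toCluster A) (F.toCluster B) := by
  refine ⟨φ, ?_⟩
  erw [eqToHom_refl, eqToHom_refl, Category.id_comp, Category.comp_id]
  rfl

/-- The morphism witnessing a relation between clusters. -/
noncomputable def Rel.lift {f : X ⟶ Y} {A : F.Cluster X} {B : F.Cluster Y} (h : F.Rel f A B) :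
    A.1 ⟶ B.1 := h.choose

theorem Rel.map_lift {f : X ⟶ Y} {A : F.Cluster X} {B : F.Cluster Y} (h : F.Rel f A B) :
    F.proj.map h.lift = eqToHom A.2 ≫ f ≫ eqToHom B.2.symm := h.choose_spec

/-- A relation-preserving family of maps of clusters as an operator. -/
noncomputable def operatorOfClusters {G : Form C} (κ : ∀ X, F.Cluster X → G.Cluster X)
    (h : ∀ {X Y : C} (f : X ⟶ Y) (A : F.Cluster X) (B : F.Cluster Y),
      F.Rel f A B → G.Rel f (κ X A) (κ Y B)) : Operator F G where
  functor :=
    { obj := fun A => (κ _ (F.toCluster A)).1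
      map := fun φ => (h _ _ _ (rel_map φ)).lift
      -- Faithfulness makes the arbitrarily chosen lifts functorial.
      map_id := fun A => G.proj.map_injective (by simp [Rel.map_lift])
      map_comp := fun φ ψ => G.proj.map_injective (by simp [Rel.map_lift]) }
  comm := by
    refine CategoryTheory.Functor.ext (fun A => (κ _ (F.toCluster A)).2) fun A B φ => ?_
    exact Rel.map_lift _

theorem operatorOfClusters_app {G : Form C} (κ : ∀ X, F.Cluster X → G.Cluster X)
    (h : ∀ {X Y : C} (f : X ⟶ Y) (A : F.Cluster X) (B : F.Cluster Y),
      F.Rel f A B → G.Rel f (κ X A) (κ Y B)) (A : F.Cluster X) :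
    (operatorOfClusters κ h).app A = κ X A := by
  obtain ⟨A, rfl⟩ := A
  rfl

theorem functor_ext_of_faithful {D E : Type*} [Category D] [Category E] (P : E ⥤ C) [P.Faithful]
    {H K : D ⥤ E} (h : ∀ A, H.obj A = K.obj A) (hP : H ⋙ P = K ⋙ P) : H = K := by
  refine CategoryTheory.Functor.ext h fun A B f => P.map_injective ?_
  simpa [eqToHom_map] using Functor.congr_hom hP f

/-- By faithfulness a form is nothing more than its clusters and the relations between them.
Injectivity comes for free, since the order on clusters is antisymmetric. -/
theorem isIsomorphic_of_clusters {G : Form C} (κ : ∀ X, F.Cluster X → G.Cluster X)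
    (h : ∀ {X Y : C} (f : X ⟶ Y) (A : F.Cluster X) (B : F.Cluster Y),
      G.Rel f (κ X A) (κ Y B) ↔ F.Rel f A B)
    (hs : ∀ X, Function.Surjective (κ X)) : F.IsIsomorphic G := by
  have hinj : ∀ X, Function.Injective (κ X) := fun X A B hAB =>
    le_antisymm ((h (𝟙 X) A B).1 (by rw [hAB]; exact le_refl (κ X B)))
      ((h (𝟙 X) B A).1 (by rw [hAB]; exact le_refl (κ X B)))
  let κ' : ∀ X, G.Cluster X → F.Cluster X := fun X B => (hs X B).choose
  have hκ' : ∀ X (B : G.Cluster X), κ X (κ' X B) = B := fun X B => (hs X B).choose_spec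
  have hκ : ∀ X (A : F.Cluster X), κ' X (κ X A) = A := fun X A => hinj X (hκ' X _)
  let φ := operatorOfClusters κ (fun f A B => (h f A B).2)
  let ψ := operatorOfClusters κ' (fun f A B r => (h f _ _).1 (by rwa [hκ', hκ']))
  refine ⟨φ.functor, ψ.functor, ?_, ?_, φ.comm⟩
  · refine functor_ext_of_faithful F.proj (fun A => ?_) ?_
    · have h₁ : ψ.app (φ.app (F.toCluster A)) = F.toCluster A := by
        dsimp only [φ, ψ]
        rw [operatorOfClusters_app, operatorOfClusters_app, hκ]
      exact congrArg Subtype.val h₁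
    · rw [Functor.assoc, ψ.comm, φ.comm, Functor.id_comp]
  · refine functor_ext_of_faithful G.proj (fun A => ?_) ?_
    · have h₁ : φ.app (ψ.app (G.toCluster A)) = G.toCluster A := by
        dsimp only [φ, ψ]
        rw [operatorOfClusters_app, operatorOfClusters_app, hκ']
      exact congrArg Subtype.val h₁
    · rw [Functor.assoc, φ.comm, ψ.comm, Functor.id_comp]

section Orean

variable [F.IsOrean]

theorem dir_le_iff {f : X ⟶ Y} {S : F.Cluster X} {T : F.Cluster Y} :
    F.dir f S ≤ T ↔ F.Rel f S T :=
  ⟨fun h => Rel.of_le_right (IsOrean.exists_dir (F := F) f S).choose_spec.1 h,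
    fun h => (IsOrean.exists_dir (F := F) f S).choose_spec.2 h⟩

theorem le_inv_iff {f : X ⟶ Y} {S : F.Cluster X} {T : F.Cluster Y} :
    S ≤ F.inv f T ↔ F.Rel f S T :=
  ⟨fun h => Rel.of_le_left h (IsOrean.exists_inv (F := F) f T).choose_spec.1,
    fun h => (IsOrean.exists_inv (F := F) f T).choose_spec.2 h⟩

variable (F) in
theorem gc (f : X ⟶ Y) : GaloisConnection (F.dir f) (F.inv f) :=
  fun _ _ => dir_le_iff.trans le_inv_iff.symm

/-- Interpolation of relations along composites is what bounds `dir g (dir f S)` by `dir (f ≫ g) S`;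
the other inequality only composes relations. -/
theorem dir_comp (f : X ⟶ Y) (g : Y ⟶ Z) (S : F.Cluster X) :
    F.dir (f ≫ g) S = F.dir g (F.dir f S) := by
  refine eq_of_forall_ge_iff fun T => ?_
  rw [dir_le_iff, dir_le_iff]
  constructor
  · intro h
    obtain ⟨B, h₁, h₂⟩ := IsOrean.exists_of_rel_comp f g S T h
    exact Rel.of_le_left (dir_le_iff.2 h₁) h₂
  · exact fun h => Rel.comp (dir_le_iff.1 le_rfl) h

theorem inv_comp (f : X ⟶ Y) (g : Y ⟶ Z) (T : F.Cluster Z) :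
    F.inv (f ≫ g) T = F.inv f (F.inv g T) := by
  refine eq_of_forall_le_iff fun S => ?_
  rw [← F.gc f, ← F.gc g, ← F.gc (f ≫ g), dir_comp]

theorem dir_id (S : F.Cluster X) : F.dir (𝟙 X) S = S :=
  eq_of_forall_ge_iff fun _ => dir_le_iff

theorem inv_id (S : F.Cluster X) : F.inv (𝟙 X) S = S :=
  eq_of_forall_le_iff fun _ => le_inv_iff

theorem im_comp (f : X ⟶ Y) (g : Y ⟶ Z) : F.im (f ≫ g) = F.dir g (F.im f) := dir_comp f g ⊤

theorem ker_comp (f : X ⟶ Y) (g : Y ⟶ Z) : F.ker (f ≫ g) = F.inv f (F.ker g) := inv_comp f g ⊥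

theorem im_comp_le (f : X ⟶ Y) (g : Y ⟶ Z) : F.im (f ≫ g) ≤ F.im g := by
  rw [im_comp]
  exact (F.gc g).monotone_l le_top

theorem ker_le_ker_comp (f : X ⟶ Y) (g : Y ⟶ Z) : F.ker f ≤ F.ker (f ≫ g) := by
  rw [ker_comp]
  exact (F.gc f).monotone_u bot_le

theorem im_id : F.im (𝟙 X) = ⊤ := dir_id ⊤

theorem ker_id : F.ker (𝟙 X) = ⊥ := inv_id ⊥

theorem im_eq_top_of_isIso (f : X ⟶ Y) [IsIso f] : F.im f = ⊤ := by
  rw [eq_top_iff, ← im_id, ← IsIso.inv_hom_id f]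
  exact im_comp_le _ _

theorem ker_eq_bot_of_isIso (f : X ⟶ Y) [IsIso f] : F.ker f = ⊥ := by
  rw [eq_bot_iff, ← ker_id, ← IsIso.hom_inv_id f]
  exact ker_le_ker_comp _ _

theorem dir_le_ker_iff {f : X ⟶ Y} {g : Y ⟶ Z} {S : F.Cluster X} :
    F.dir f S ≤ F.ker g ↔ S ≤ F.ker (f ≫ g) := by
  rw [ker_comp, F.gc f]

theorem normalCluster_inv (f : X ⟶ Y) {T : F.Cluster Y} (h : F.NormalCluster T) :
    F.NormalCluster (F.inv f T) := by
  obtain ⟨W, g, rfl⟩ := h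
  exact ⟨W, f ≫ g, ker_comp f g⟩

theorem conormalCluster_dir (f : X ⟶ Y) {S : F.Cluster X} (h : F.ConormalCluster S) :
    F.ConormalCluster (F.dir f S) := by
  obtain ⟨W, g, rfl⟩ := h
  exact ⟨W, g ≫ f, im_comp g f⟩

theorem normalCluster_bot : F.NormalCluster (⊥ : F.Cluster X) := ⟨X, 𝟙 X, ker_id⟩

theorem conormalCluster_top : F.ConormalCluster (⊤ : F.Cluster X) := ⟨X, 𝟙 X, im_id⟩

theorem IsEmbeddingOf.mono {f : Y ⟶ X} {S : F.Cluster X} (h : F.IsEmbeddingOf f S) : Mono f :=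
  ⟨fun g _ hg => (h.2 (g ≫ f) ((im_comp_le g f).trans h.1.le)).unique rfl hg.symm⟩

theorem IsQuotientOf.epi {f : X ⟶ Y} {S : F.Cluster X} (h : F.IsQuotientOf f S) : Epi f :=
  ⟨fun g _ hg => (h.2 (f ≫ g) (h.1.ge.trans (ker_le_ker_comp f g))).unique rfl hg.symm⟩

end Orean

/-! ### Embeddings, quotients, pullbacks and pushouts in a noetherian form -/

section Noetherian

variable [F.IsNoetherian]

open FormTheory.Form.IsNoetherian

/-- The quotient part of the factorization has kernel `⊥`, so the identity factors through it; being
also epi, it is an isomorphism, and `f` agrees with its embedding part up to isomorphism. -/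
theorem isEmbeddingOf_of_ker_eq_bot {f : X ⟶ Y} (h : F.ker f = ⊥) : F.IsEmbeddingOf f (F.im f) := by
  obtain ⟨W, e, m, he, hm, hf⟩ := factorization (F := F) f
  have := he.epi
  obtain ⟨r, hr, -⟩ := he.2 (𝟙 X) (h ▸ bot_le)
  have : IsSplitMono e := ⟨⟨r, hr⟩⟩
  have : IsIso e := isIso_of_epi_of_isSplitMono e
  refine ⟨rfl, fun V f' hf' => ?_⟩
  obtain ⟨g, hg, hu⟩ := hm.2 f' hf'
  refine ⟨g ≫ CategoryTheory.inv e, by simp [← hf, hg], fun g' hg' => ?_⟩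
  rw [← hu (g' ≫ e) (by simp [hf, hg'])]
  simp

theorem isQuotientOf_of_im_eq_top {f : X ⟶ Y} (h : F.im f = ⊤) : F.IsQuotientOf f (F.ker f) := by
  obtain ⟨W, e, m, he, hm, hf⟩ := factorization (F := F) f
  have := hm.mono
  obtain ⟨r, hr, -⟩ := hm.2 (𝟙 Y) (h ▸ le_top)
  have : IsSplitEpi m := ⟨⟨r, hr⟩⟩
  have : IsIso m := isIso_of_mono_of_isSplitEpi m
  refine ⟨rfl, fun V f' hf' => ?_⟩
  obtain ⟨g, hg, hu⟩ := he.2 f' hf'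
  refine ⟨CategoryTheory.inv m ≫ g, by simp [← hf, hg], fun g' hg' => ?_⟩
  rw [← hu (m ≫ g') (by simp [← hg', ← hf])]
  simp

/-- Both `f` and the embedding part of its factorization embed the same cluster, so the quotient
part is invertible and has kernel `⊥`. -/
theorem IsEmbeddingOf.ker_eq_bot {f : X ⟶ Y} {S : F.Cluster Y} (h : F.IsEmbeddingOf f S) :
    F.ker f = ⊥ := by
  obtain ⟨W, e, m, he, hm, hf⟩ := factorization (F := F) f
  have := he.epi
  have := hm.mono
  have := h.mono
  obtain ⟨r, hr, -⟩ := h.2 m (by rw [hm.1, h.1])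
  have h₁ : r ≫ e = 𝟙 W := by rw [← cancel_mono m, Category.assoc, hf, hr, Category.id_comp]
  have h₂ : e ≫ r = 𝟙 X := by rw [← cancel_mono f, Category.assoc, hr, hf, Category.id_comp]
  have : IsIso e := ⟨r, h₂, h₁⟩
  rw [← he.1, ker_eq_bot_of_isIso]

theorem IsQuotientOf.im_eq_top {f : X ⟶ Y} {S : F.Cluster X} (h : F.IsQuotientOf f S) :
    F.im f = ⊤ := by
  obtain ⟨W, e, m, he, hm, hf⟩ := factorization (F := F) f
  have := he.epi
  have := hm.mono
  have := h.epi
  obtain ⟨r, hr, -⟩ := h.2 e (by rw [he.1, h.1])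
  have h₁ : m ≫ r = 𝟙 W := by
    rw [← cancel_epi e, ← Category.assoc, hf, hr, Category.comp_id]
  have h₂ : r ≫ m = 𝟙 Y := by
    rw [← cancel_epi f, ← Category.assoc, hr, hf, Category.comp_id]
  have : IsIso m := ⟨r, h₁, h₂⟩
  rw [← hm.1, im_eq_top_of_isIso]

theorem embeddings_iff {f : X ⟶ Y} : F.embeddings f ↔ F.ker f = ⊥ :=
  ⟨fun ⟨_, _, h⟩ => h.ker_eq_bot,
    fun h => ⟨_, ⟨X, f, rfl⟩, isEmbeddingOf_of_ker_eq_bot h⟩⟩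

theorem quotients_iff {f : X ⟶ Y} : F.quotients f ↔ F.im f = ⊤ :=
  ⟨fun ⟨_, _, h⟩ => h.im_eq_top,
    fun h => ⟨_, ⟨Y, f, rfl⟩, isQuotientOf_of_im_eq_top h⟩⟩

theorem exists_factorization (f : X ⟶ Y) : ∃ (W : C) (e : X ⟶ W) (m : W ⟶ Y),
    F.im e = ⊤ ∧ F.ker m = ⊥ ∧ e ≫ m = f := by
  obtain ⟨W, e, m, he, hm, hf⟩ := factorization (F := F) f
  exact ⟨W, e, m, he.im_eq_top, hm.ker_eq_bot, hf⟩

theorem exists_embedding {S : F.Cluster X} (h : F.ConormalCluster S) :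
    ∃ (W : C) (m : W ⟶ X), F.ker m = ⊥ ∧ F.im m = S := by
  obtain ⟨V, f, rfl⟩ := h
  obtain ⟨W, e, m, he, hm, hf⟩ := factorization (F := F) f
  exact ⟨W, m, hm.ker_eq_bot, hm.1⟩

theorem exists_quotient {S : F.Cluster X} (h : F.NormalCluster S) :
    ∃ (W : C) (e : X ⟶ W), F.im e = ⊤ ∧ F.ker e = S := by
  obtain ⟨V, f, rfl⟩ := h
  obtain ⟨W, e, m, he, hm, hf⟩ := factorization (F := F) f
  exact ⟨W, e, he.im_eq_top, he.1⟩

theorem inv_dir_of_ker_eq_bot {m : X ⟶ Y} (h : F.ker m = ⊥) (S : F.Cluster X) :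
    F.inv m (F.dir m S) = S := by
  rw [inv_dir, h, sup_bot_eq]

theorem dir_inv_of_im_eq_top {e : X ⟶ Y} (h : F.im e = ⊤) (T : F.Cluster Y) :
    F.dir e (F.inv e T) = T := by
  rw [dir_inv, h, inf_top_eq]

theorem dir_injective {m : X ⟶ Y} (h : F.ker m = ⊥) : Function.Injective (F.dir m) :=
  Function.LeftInverse.injective (inv_dir_of_ker_eq_bot h)

theorem inv_injective {e : X ⟶ Y} (h : F.im e = ⊤) : Function.Injective (F.inv e) :=
  Function.LeftInverse.injective (dir_inv_of_im_eq_top h)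

theorem mono_of_ker_eq_bot {m : X ⟶ Y} (h : F.ker m = ⊥) : Mono m :=
  (isEmbeddingOf_of_ker_eq_bot h).mono

theorem epi_of_im_eq_top {e : X ⟶ Y} (h : F.im e = ⊤) : Epi e :=
  (isQuotientOf_of_im_eq_top h).epi

theorem exists_lift {m : X ⟶ Y} (h : F.ker m = ⊥) {f : W ⟶ Y} (hf : F.im f ≤ F.im m) :
    ∃ g, g ≫ m = f :=
  ((isEmbeddingOf_of_ker_eq_bot h).2 f hf).exists

theorem exists_desc {e : X ⟶ Y} (h : F.im e = ⊤) {f : X ⟶ W} (hf : F.ker e ≤ F.ker f) :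
    ∃ g, e ≫ g = f :=
  ((isQuotientOf_of_im_eq_top h).2 f hf).exists

/-- Any cone leg into `Y` has image inside `inv f (im m)`, hence lifts through the embedding `m'`.
-/
theorem isPullback_of_inv_eq {P : C} {g : P ⟶ X} {m' : P ⟶ Y} {m : X ⟶ Z} {f : Y ⟶ Z}
    (hm : F.ker m = ⊥) (hm' : F.ker m' = ⊥) (w : g ≫ m = m' ≫ f)
    (h : F.inv f (F.im m) ≤ F.im m') : IsPullback g m' m f := by
  have := mono_of_ker_eq_bot hm
  have := mono_of_ker_eq_bot hm'
  have key : ∀ s : Limits.PullbackCone m f, ∃ l, l ≫ m' = s.snd := fun s => by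
    refine exists_lift hm' (le_trans ?_ h)
    rw [← F.gc f, ← im_comp, ← s.condition]
    exact im_comp_le _ _
  choose l hl using key
  refine ⟨⟨w⟩, ⟨Limits.PullbackCone.IsLimit.mk w l (fun s => ?_) hl fun s t _ ht => ?_⟩⟩
  · rw [← cancel_mono m, Category.assoc, w, ← Category.assoc, hl, s.condition]
  · rw [← cancel_mono m', hl, ht]

/-- The direct image of `ker e` need not be normal, so the kernel of `e'` is compared only with
kernels lying above that image. -/
theorem isPushout_of_le_ker {P : C} {e : X ⟶ Y} {f : X ⟶ Z} {n : Y ⟶ P} {e' : Z ⟶ P}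
    (he : F.im e = ⊤) (he' : F.im e' = ⊤) (w : e ≫ n = f ≫ e')
    (h : ∀ {W : C} (g : Z ⟶ W), F.dir f (F.ker e) ≤ F.ker g → F.ker e' ≤ F.ker g) :
    IsPushout e f n e' := by
  have := epi_of_im_eq_top he
  have := epi_of_im_eq_top he'
  have key : ∀ s : Limits.PushoutCocone e f, ∃ l, e' ≫ l = s.inr := fun s => by
    refine exists_desc he' (h _ ?_)
    rw [dir_le_ker_iff, ← s.condition]
    exact ker_le_ker_comp _ _
  choose l hl using key
  refine ⟨⟨w⟩, ⟨Limits.PushoutCocone.IsColimit.mk w l (fun s => ?_) hl fun s t _ ht => ?_⟩⟩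
  · rw [← cancel_epi e, ← Category.assoc, w, Category.assoc, hl, s.condition]
  · rw [← cancel_epi e', hl, ht]

end Noetherian

end Form

end FormTheory

/-! ### Operators and closed clusters -/

namespace FormTheory

namespace Operator

open Form

variable {C : Type u} [Category.{v} C] {F G H : Form C} {X Y Z : C}

theorem rel_app (τ : Operator F G) {f : X ⟶ Y} {A : F.Cluster X} {B : F.Cluster Y} :
    F.Rel f A B → G.Rel f (τ.app A) (τ.app B) := by
  obtain ⟨A, rfl⟩ := A
  obtain ⟨B, rfl⟩ := B
  rintro ⟨φ, hφ⟩
  obtain rfl : F.proj.map φ = f := by simpa using hφ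
  exact ⟨τ.functor.map φ, Functor.congr_hom τ.comm φ⟩

theorem app_mono (τ : Operator F G) : Monotone (τ.app (X := X)) := fun _ _ h => τ.rel_app h

/-- Composition of operators. -/
def comp (τ : Operator F G) (σ : Operator G H) : Operator F H where
  functor := τ.functor ⋙ σ.functor
  comm := by rw [Functor.assoc, σ.comm, τ.comm]

variable (κ : Operator F F)

/-- A closed cluster, as a cluster of the subform of closed clusters. -/
def ofClosed (A : F.Cluster X) (h : κ.app A = A) : κ.closed.Cluster X :=
  ⟨⟨A.1, congrArg Subtype.val h⟩, A.2⟩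

theorem inclusion_ofClosed (A : F.Cluster X) (h : κ.app A = A) :
    κ.inclusion.app (κ.ofClosed A h) = A := rfl

theorem app_inclusion (A : κ.closed.Cluster X) :
    κ.app (κ.inclusion.app A) = κ.inclusion.app A := Subtype.ext A.1.2

theorem inclusion_rel_iff {f : X ⟶ Y} {A : κ.closed.Cluster X} {B : κ.closed.Cluster Y} :
    F.Rel f (κ.inclusion.app A) (κ.inclusion.app B) ↔ κ.closed.Rel f A B :=
  ⟨fun ⟨φ, hφ⟩ => ⟨⟨φ⟩, hφ⟩, fun h => κ.inclusion.rel_app h⟩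

theorem inclusion_le_iff {A B : κ.closed.Cluster X} :
    κ.inclusion.app A ≤ κ.inclusion.app B ↔ A ≤ B := κ.inclusion_rel_iff

theorem inclusion_injective : Function.Injective (κ.inclusion.app (X := X)) := fun _ _ h =>
  le_antisymm (κ.inclusion_le_iff.1 h.le) (κ.inclusion_le_iff.1 h.ge)

theorem inclusion_restriction (h : κ.IsIdempotent) (A : F.Cluster X) :
    κ.inclusion.app ((κ.restriction h).app A) = κ.app A := rfl

/-- Idempotent operators that enlarge clusters. -/
structure IsClosure (κ : Operator F F) : Prop where
  idem : κ.IsIdempotent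
  le : ∀ {X : C} (A : F.Cluster X), A ≤ κ.app A

variable {κ}

theorem IsIdempotent.app_app (h : κ.IsIdempotent) (A : F.Cluster X) :
    κ.app (κ.app A) = κ.app A :=
  Subtype.ext (Functor.congr_obj h A.1)

theorem isIdempotent_of_app (h : ∀ {X : C} (A : F.Cluster X), κ.app (κ.app A) = κ.app A) :
    κ.IsIdempotent :=
  functor_ext_of_faithful F.proj (fun A => congrArg Subtype.val (h (F.toCluster A))) (by
    rw [Functor.assoc, κ.comm, κ.comm])

namespace IsClosure

variable (h : κ.IsClosure)
include h

/-- Closed clusters are reflective over every morphism, not just over identities. This is what makes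
the inverse image of a closed cluster closed. -/
theorem app_rel_iff {f : X ⟶ Y} {A : F.Cluster X} {B : κ.closed.Cluster Y} :
    F.Rel f (κ.app A) (κ.inclusion.app B) ↔ F.Rel f A (κ.inclusion.app B) :=
  ⟨fun r => Rel.of_le_left (h.le A) r, fun r => by
    rw [← app_inclusion]
    exact κ.rel_app r⟩

theorem app_le_iff {A : F.Cluster X} {B : κ.closed.Cluster X} :
    κ.app A ≤ κ.inclusion.app B ↔ A ≤ κ.inclusion.app B := h.app_rel_iff

theorem app_inv_inclusion [F.IsOrean] (f : X ⟶ Y) (B : κ.closed.Cluster Y) :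
    κ.app (F.inv f (κ.inclusion.app B)) = F.inv f (κ.inclusion.app B) :=
  le_antisymm (le_inv_iff.2 (h.app_rel_iff.2 (le_inv_iff.1 le_rfl))) (h.le _)

/-- Top, meets and inverse images are those of `F`; bottom, joins and direct images are the closures
of those of `F`. -/
theorem closed_isOrean [F.IsOrean] : κ.closed.IsOrean where
  isBoundedLattice X :=
    { exists_top := ⟨κ.ofClosed ⊤ (le_antisymm le_top (h.le _)),
        fun _ => κ.inclusion_le_iff.1 le_top⟩
      exists_bot := ⟨(κ.restriction h.idem).app ⊥, fun _ => κ.inclusion_le_iff.1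
        (h.app_le_iff.2 bot_le)⟩
      exists_sup := fun A B => by
        refine ⟨(κ.restriction h.idem).app (κ.inclusion.app A ⊔ κ.inclusion.app B), ?_, ?_⟩
        · rintro _ (rfl | rfl)
          exacts [κ.inclusion_le_iff.1 (le_sup_left.trans (h.le _)),
            κ.inclusion_le_iff.1 (le_sup_right.trans (h.le _))]
        · intro D hD
          exact κ.inclusion_le_iff.1 (h.app_le_iff.2
            (sup_le (κ.inclusion_le_iff.2 (hD (by simp))) (κ.inclusion_le_iff.2 (hD (by simp)))))
      exists_inf := fun A B => by
        refine ⟨κ.ofClosed (κ.inclusion.app A ⊓ κ.inclusion.app B) (le_antisymm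
          (le_inf (h.app_le_iff.2 inf_le_left) (h.app_le_iff.2 inf_le_right)) (h.le _)), ?_, ?_⟩
        · rintro _ (rfl | rfl)
          exacts [κ.inclusion_le_iff.1 inf_le_left, κ.inclusion_le_iff.1 inf_le_right]
        · intro D hD
          exact κ.inclusion_le_iff.1
            (le_inf (κ.inclusion_le_iff.2 (hD (by simp))) (κ.inclusion_le_iff.2 (hD (by simp)))) }
  exists_of_rel_comp f g A D r := by
    obtain ⟨B, h₁, h₂⟩ := IsOrean.exists_of_rel_comp f g _ _ (κ.inclusion_rel_iff.2 r)
    refine ⟨(κ.restriction h.idem).app B, κ.inclusion_rel_iff.1 ?_, κ.inclusion_rel_iff.1 ?_⟩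
    · exact Rel.of_le_right h₁ (h.le _)
    · exact h.app_rel_iff.2 h₂
  exists_dir f S := by
    refine ⟨(κ.restriction h.idem).app (F.dir f (κ.inclusion.app S)), ?_, fun T hT => ?_⟩
    · exact κ.inclusion_rel_iff.1 (dir_le_iff.1 (h.le _))
    · exact κ.inclusion_le_iff.1 (h.app_le_iff.2 (dir_le_iff.2 (κ.inclusion_rel_iff.2 hT)))
  exists_inv f T := by
    refine ⟨κ.ofClosed (F.inv f (κ.inclusion.app T)) (h.app_inv_inclusion f T), ?_, fun S hS => ?_⟩
    · exact κ.inclusion_rel_iff.1 (le_inv_iff.1 le_rfl)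
    · exact κ.inclusion_le_iff.1 (le_inv_iff.2 (κ.inclusion_rel_iff.2 hS))

variable [F.IsOrean] [κ.closed.IsOrean]

theorem inclusion_top : κ.inclusion.app (⊤ : κ.closed.Cluster X) = ⊤ := by
  refine top_unique ?_
  have h₁ : κ.ofClosed (⊤ : F.Cluster X) (le_antisymm le_top (h.le _)) ≤ ⊤ := le_top
  exact κ.inclusion_le_iff.2 h₁

theorem inclusion_bot : κ.inclusion.app (⊥ : κ.closed.Cluster X) = κ.app ⊥ := by
  refine le_antisymm ?_ (h.app_le_iff.2 bot_le)
  have h₁ : ⊥ ≤ (κ.restriction h.idem).app (⊥ : F.Cluster X) := bot_le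
  exact κ.inclusion_le_iff.2 h₁

theorem inclusion_dir (f : X ⟶ Y) (S : κ.closed.Cluster X) :
    κ.inclusion.app (κ.closed.dir f S) = κ.app (F.dir f (κ.inclusion.app S)) := by
  refine le_antisymm ?_ ?_
  · have h₁ : κ.closed.dir f S ≤ (κ.restriction h.idem).app (F.dir f (κ.inclusion.app S)) :=
      dir_le_iff.2 (κ.inclusion_rel_iff.1 (dir_le_iff.1 (h.le _)))
    exact κ.inclusion_le_iff.2 h₁
  · exact h.app_le_iff.2 (dir_le_iff.2 (κ.inclusion_rel_iff.2 (dir_le_iff.1 le_rfl)))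

theorem inclusion_inv (f : X ⟶ Y) (T : κ.closed.Cluster Y) :
    κ.inclusion.app (κ.closed.inv f T) = F.inv f (κ.inclusion.app T) := by
  refine le_antisymm ?_ ?_
  · exact le_inv_iff.2 (κ.inclusion_rel_iff.2 (le_inv_iff.1 le_rfl))
  · have h₁ : κ.ofClosed (F.inv f (κ.inclusion.app T)) (h.app_inv_inclusion f T) ≤
        κ.closed.inv f T := le_inv_iff.2 (κ.inclusion_rel_iff.1 (le_inv_iff.1 le_rfl))
    exact κ.inclusion_le_iff.2 h₁

theorem inclusion_im (f : X ⟶ Y) :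
    κ.inclusion.app (κ.closed.im f) = κ.app (F.im f) := by
  rw [im, h.inclusion_dir, h.inclusion_top, im]

theorem inclusion_ker (f : X ⟶ Y) :
    κ.inclusion.app (κ.closed.ker f) = F.inv f (κ.app ⊥) := by
  rw [ker, h.inclusion_inv, h.inclusion_bot]

end IsClosure

end Operator

/-! ### Exact meet decompositions as pairs of closure operators -/

open Form Operator

variable {C : Type u} [Category.{v} C] {F : Form C} {X Y Z : C}

/-- Closure operators `κs` and `κe` onto the conormal and the normal clusters, of which every
cluster is a meet, and with `κs` compatible with kernels. -/
structure IsClosurePair [F.IsOrean] (κs κe : Operator F F) : Prop where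
  closure_s : κs.IsClosure
  closure_e : κe.IsClosure
  app_s_eq_iff : ∀ {X : C} {A : F.Cluster X}, κs.app A = A ↔ F.ConormalCluster A
  app_e_eq_iff : ∀ {X : C} {A : F.Cluster X}, κe.app A = A ↔ F.NormalCluster A
  inf_le : ∀ {X : C} (A : F.Cluster X), κs.app A ⊓ κe.app A ≤ A
  app_s_ker : ∀ {X Y : C} (f : X ⟶ Y), κs.app (F.ker f) = F.inv f (κs.app ⊥)

/-- The meet formula makes both operators enlarging. Closed clusters are images (kernels) in the
conormal (normal) subform, and the inclusions identify these with images (kernels) in `F`.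
Compatibility with kernels is normality of the restriction of `κs`. -/
theorem IsExactMeetDecomposition.isClosurePair [F.IsOrean] {κs κe : Operator F F}
    (h : IsExactMeetDecomposition κs κe) : IsClosurePair κs κe := by
  have := h.conormalForm_s
  have := h.normalForm_e
  have hs : κs.IsClosure := ⟨h.idem_s, fun A => by
    conv_lhs => rw [h.eq_inf A]
    exact inf_le_left⟩
  have he : κe.IsClosure := ⟨h.idem_e, fun A => by
    conv_lhs => rw [h.eq_inf A]
    exact inf_le_right⟩
  refine ⟨hs, he, fun {X A} => ⟨fun hA => ?_, ?_⟩, fun {X A} => ⟨fun hA => ?_, ?_⟩,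
    fun A => (h.eq_inf A).ge, fun f => ?_⟩
  · obtain ⟨W, f, hf⟩ := IsConormalForm.conormal (κs.ofClosed A hA)
    refine ⟨W, f, ?_⟩
    rw [← h.incl_s_conormal f, hf, inclusion_ofClosed]
  · rintro ⟨W, f, rfl⟩
    rw [← h.incl_s_conormal f, app_inclusion]
  · obtain ⟨W, f, hf⟩ := IsNormalForm.normal (κe.ofClosed A hA)
    refine ⟨W, f, ?_⟩
    rw [← h.incl_e_normal f, hf, inclusion_ofClosed]
  · rintro ⟨W, f, rfl⟩
    rw [← h.incl_e_normal f, app_inclusion]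
  · rw [← inclusion_restriction κs h.idem_s, h.proj_s_normal f, hs.inclusion_ker]

/-- Images in `F` are already `κs`-closed and `⊥` is `κe`-closed, so the inclusions preserve images
and kernels respectively. The two operators between the subforms are an inclusion into `F` followed
by the other restriction. -/
theorem IsClosurePair.isExactMeetDecomposition [F.IsOrean] {κs κe : Operator F F}
    (h : IsClosurePair κs κe) : IsExactMeetDecomposition κs κe := by
  have := h.closure_s.closed_isOrean
  have := h.closure_e.closed_isOrean
  have ims : ∀ {X Y : C} (f : X ⟶ Y), κs.inclusion.app (κs.closed.im f) = F.im f := fun f => by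
    rw [h.closure_s.inclusion_im, h.app_s_eq_iff]
    exact ⟨_, f, rfl⟩
  have kere : ∀ {X Y : C} (f : X ⟶ Y), κe.inclusion.app (κe.closed.ker f) = F.ker f := fun f => by
    rw [h.closure_e.inclusion_ker, h.app_e_eq_iff.2 normalCluster_bot, ker]
  have : κs.closed.IsConormalForm := ⟨fun {X} S => by
    obtain ⟨W, f, hf⟩ := h.app_s_eq_iff.1 (app_inclusion κs S)
    exact ⟨W, f, inclusion_injective κs (by rw [ims, hf])⟩⟩
  have : κe.closed.IsNormalForm := ⟨fun {X} S => by
    obtain ⟨W, f, hf⟩ := h.app_e_eq_iff.1 (app_inclusion κe S)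
    exact ⟨W, f, inclusion_injective κe (by rw [kere, hf])⟩⟩
  have psc : (κs.restriction h.closure_s.idem).IsConormal := fun f => inclusion_injective κs (by
    rw [inclusion_restriction, h.closure_s.inclusion_im])
  have psn : (κs.restriction h.closure_s.idem).IsNormal := fun f => inclusion_injective κs (by
    rw [inclusion_restriction, h.closure_s.inclusion_ker, h.app_s_ker])
  have pec : (κe.restriction h.closure_e.idem).IsConormal := fun f => inclusion_injective κe (by
    rw [inclusion_restriction, h.closure_e.inclusion_im])
  have pen : (κe.restriction h.closure_e.idem).IsNormal := fun f => inclusion_injective κe (by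
    rw [inclusion_restriction, kere, h.app_e_eq_iff]
    exact ⟨_, f, rfl⟩)
  exact
    { idem_s := h.closure_s.idem
      idem_e := h.closure_e.idem
      eq_inf := fun S => le_antisymm (le_inf (h.closure_s.le S) (h.closure_e.le S)) (h.inf_le S)
      proj_s_conormal := psc
      proj_s_normal := psn
      proj_e_conormal := pec
      proj_e_normal := pen
      semiexact := ⟨⟨κs.inclusion.comp (κe.restriction h.closure_e.idem), fun f =>
          (congrArg (κe.restriction h.closure_e.idem).app (ims f)).trans (pec f)⟩,
        ⟨κe.inclusion.comp (κs.restriction h.closure_s.idem), fun f =>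
          (congrArg (κs.restriction h.closure_s.idem).app (kere f)).trans (psn f)⟩⟩
      incl_s_conormal := ims
      incl_e_normal := kere }

end FormTheory

/-! ### From emd-noetherian forms to bicategory structures -/

namespace FormTheory

variable {C : Type u} [Category.{v} C]

/-- A form is presented by a bicategory structure when its clusters are the classes of pairs
`[e, m]` with left trivial codomain of `e`, related as subquotients are. -/
structure Presents (S : BicategoryStructure C) (F : Form C) where
  cl : ∀ {X : C} (p : S.Span X), S.LeftTrivial p.cod → F.Cluster X
  rel_iff : ∀ {X Y : C} (f : X ⟶ Y) (p : S.Span X) (hp : S.LeftTrivial p.cod) (q : S.Span Y)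
    (hq : S.LeftTrivial q.cod), F.Rel f (cl p hp) (cl q hq) ↔ p.Rel f q
  exists_cl_eq : ∀ {X : C} (A : F.Cluster X), ∃ (p : S.Span X) (hp : S.LeftTrivial p.cod),
    cl p hp = A

/-- A presentation fixes clusters and relations in terms of `S` alone. The span chosen to represent
a cluster may vary, but only within its equivalence class. -/
theorem Presents.isIsomorphic {S : BicategoryStructure C} {F G : Form C} (hF : Presents S F)
    (hG : Presents S G) : F.IsIsomorphic G := by
  choose p hp hpA using fun (X : C) => hF.exists_cl_eq (X := X)
  refine Form.isIsomorphic_of_clusters (fun X A => hG.cl (p X A) (hp X A)) ?_ ?_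
  · intro X Y f A B
    rw [hG.rel_iff, ← hF.rel_iff f _ (hp X A) _ (hp Y B), hpA, hpA]
  · intro X B
    obtain ⟨q, hq, rfl⟩ := hG.exists_cl_eq B
    refine ⟨hF.cl q hq, le_antisymm ?_ ?_⟩
    · rw [Form.le_iff_rel, hG.rel_iff, ← hF.rel_iff _ _ (hp X _) _ hq, hpA]
      exact le_refl (hF.cl q hq)
    · rw [Form.le_iff_rel, hG.rel_iff, ← hF.rel_iff _ _ hq _ (hp X _), hpA]
      exact le_refl (hF.cl q hq)

open Form

/-- The bicategory structure of quotients and embeddings of a form. -/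
def Form.bicategoryStructure (F : Form C) [F.IsOrean] : BicategoryStructure C :=
  ⟨F.quotients, F.embeddings⟩

variable {F : Form C} [F.IsNoetherian] {W X Y Z P Q : C}

theorem bicategoryStructure_right_iff {f : X ⟶ Y} :
    F.bicategoryStructure.right f ↔ F.im f = ⊤ := quotients_iff

theorem bicategoryStructure_left_iff {f : X ⟶ Y} :
    F.bicategoryStructure.left f ↔ F.ker f = ⊥ := embeddings_iff

theorem isProperFactorizationSystem : F.bicategoryStructure.IsProperFactorizationSystem where
  right_of_isIso f _ := bicategoryStructure_right_iff.2 (im_eq_top_of_isIso f)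
  left_of_isIso f _ := bicategoryStructure_left_iff.2 (ker_eq_bot_of_isIso f)
  right_comp f g hf hg := by
    rw [bicategoryStructure_right_iff] at *
    rw [im_comp, hf, ← hg, im]
  left_comp f g hf hg := by
    rw [bicategoryStructure_left_iff] at *
    rw [ker_comp, hg, ← hf, ker]
  factorization f := by
    simpa only [bicategoryStructure_right_iff, bicategoryStructure_left_iff]
      using exists_factorization (F := F) f
  diagonal e f g m he hm w := by
    rw [bicategoryStructure_right_iff] at he
    rw [bicategoryStructure_left_iff] at hm
    have := mono_of_ker_eq_bot hm
    have := epi_of_im_eq_top he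
    have h₁ : F.im f ≤ F.im m := by
      have h₂ : F.im f = F.im (e ≫ f) := by rw [im_comp, he, im]
      rw [h₂, w]
      exact im_comp_le g m
    obtain ⟨d, hd⟩ := exists_lift hm h₁
    refine ⟨d, ⟨?_, hd⟩, fun d' hd' => ?_⟩
    · rw [← cancel_mono m, Category.assoc, hd, w]
    · rw [← cancel_mono m, hd, hd'.2]
  epi_of_right f hf := epi_of_im_eq_top (bicategoryStructure_right_iff.1 hf)
  mono_of_left f hf := mono_of_ker_eq_bot (bicategoryStructure_left_iff.1 hf)

namespace IsClosurePair

variable {κs κe : Operator F F} (h : IsClosurePair κs κe)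
include h

theorem app_s_le {A B : F.Cluster X} (hB : F.ConormalCluster B) (hAB : A ≤ B) : κs.app A ≤ B := by
  rw [← h.app_s_eq_iff.2 hB]
  exact κs.app_mono hAB

theorem app_e_le {A B : F.Cluster X} (hB : F.NormalCluster B) (hAB : A ≤ B) : κe.app A ≤ B := by
  rw [← h.app_e_eq_iff.2 hB]
  exact κe.app_mono hAB

theorem conormalCluster_app (A : F.Cluster X) : F.ConormalCluster (κs.app A) :=
  h.app_s_eq_iff.1 (h.closure_s.idem.app_app A)

theorem normalCluster_app (A : F.Cluster X) : F.NormalCluster (κe.app A) :=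
  h.app_e_eq_iff.1 (h.closure_e.idem.app_app A)

theorem normalCluster_top : F.NormalCluster (⊤ : F.Cluster X) :=
  h.app_e_eq_iff.1 (top_unique (h.closure_e.le _))

/-- Applying `κs` to the relation `inv f T ≤_f T` leaves `T` fixed, so the closure of `inv f T` is
again below `inv f T`. -/
theorem conormalCluster_inv (f : X ⟶ Y) {T : F.Cluster Y} (hT : F.ConormalCluster T) :
    F.ConormalCluster (F.inv f T) := by
  refine h.app_s_eq_iff.1 (le_antisymm (le_inv_iff.2 ?_) (h.closure_s.le _))
  have h₁ := κs.rel_app (le_inv_iff.1 (le_refl (F.inv f T)))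
  rwa [h.app_s_eq_iff.2 hT] at h₁

theorem dir_app_s (f : X ⟶ Y) (A : F.Cluster X) : F.dir f (κs.app A) = κs.app (F.dir f A) :=
  le_antisymm (dir_le_iff.2 (κs.rel_app (dir_le_iff.1 le_rfl)))
    (h.app_s_le (conormalCluster_dir f (h.conormalCluster_app A))
      ((F.gc f).monotone_l (h.closure_s.le A)))

/-- The closure `κs ⊥` is the least conormal cluster, so its embedding is the least left subobject.
-/
theorem isInitialLeft_iff {z : X ⟶ Y} :
    F.bicategoryStructure.IsInitialLeft z ↔ F.ker z = ⊥ ∧ F.im z = κs.app ⊥ := by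
  constructor
  · rintro ⟨hz, hu⟩
    rw [bicategoryStructure_left_iff] at hz
    refine ⟨hz, le_antisymm ?_ (h.app_s_le ⟨_, z, rfl⟩ bot_le)⟩
    obtain ⟨W, m, hm, hm'⟩ := exists_embedding (h.conormalCluster_app (⊥ : F.Cluster Y))
    obtain ⟨w, hw, -⟩ := hu m (bicategoryStructure_left_iff.2 hm)
    rw [← hm', ← hw]
    exact im_comp_le w m
  · rintro ⟨hz, hz'⟩
    refine ⟨bicategoryStructure_left_iff.2 hz, fun W m hm => ?_⟩
    rw [bicategoryStructure_left_iff] at hm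
    refine (isEmbeddingOf_of_ker_eq_bot hm).2 z ?_
    rw [hz']
    exact h.app_s_le ⟨_, m, rfl⟩ bot_le

theorem leftTrivial_iff : F.bicategoryStructure.LeftTrivial X ↔ κs.app (⊥ : F.Cluster X) = ⊤ := by
  constructor
  · rintro ⟨Y, z, hz⟩
    rw [h.isInitialLeft_iff] at hz
    -- Here `⊥` is read as `ker z`, whose closure is the inverse image along `z` of `κs ⊥ = im z`,
    -- hence `⊤`.
    rw [← hz.1, h.app_s_ker, ← hz.2, eq_top_iff, ← F.gc z, im]
  · intro hX
    exact ⟨X, 𝟙 X, h.isInitialLeft_iff.2 ⟨ker_id, by rw [im_id, hX]⟩⟩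

/-- Since `⊤` is normal, a terminal quotient `e` has kernel `⊤`. Then `⊤ = κs (ker e)` is the
inverse image of `κs ⊥`, and applying the direct image along `e` yields `κs ⊥ = ⊤`. -/
theorem leftTrivial_of_rightTrivial (hX : F.bicategoryStructure.RightTrivial X) :
    F.bicategoryStructure.LeftTrivial X := by
  obtain ⟨Y, e, he, hu⟩ := hX
  rw [bicategoryStructure_right_iff] at he
  obtain ⟨W, e', he', hk⟩ := exists_quotient (h.normalCluster_top (X := Y))
  obtain ⟨w, hw, -⟩ := hu e' (bicategoryStructure_right_iff.2 he')
  have h₁ : F.ker e = ⊤ := by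
    rw [eq_top_iff, ← hk, ← hw]
    exact ker_le_ker_comp _ _
  have h₂ := h.app_s_ker e
  rw [h₁, h.app_s_eq_iff.2 conormalCluster_top] at h₂
  rw [h.leftTrivial_iff, ← dir_inv_of_im_eq_top he (κs.app ⊥), ← h₂, ← he, im]

theorem im_eq_of_isPullback {g : P ⟶ X} {m' : P ⟶ Y} {m : X ⟶ Z} {f : Y ⟶ Z}
    (hm : F.ker m = ⊥) (sq : IsPullback g m' m f) : F.im m' = F.inv f (F.im m) := by
  refine le_antisymm ?_ ?_
  · rw [← F.gc f, ← im_comp, ← sq.w]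
    exact im_comp_le g m
  · obtain ⟨W, n, hn, hn'⟩ := exists_embedding (h.conormalCluster_inv f ⟨X, m, rfl⟩)
    have h₁ : F.im (n ≫ f) ≤ F.im m := by
      rw [im_comp, F.gc f, hn']
    obtain ⟨w, hw⟩ := exists_lift hm h₁
    rw [← hn', ← sq.lift_snd w n hw]
    exact im_comp_le _ _

/-- A quotient of the normal closure of the direct image of `ker e` is a cocone, so it factors
through `e'`. -/
theorem ker_eq_of_isPushout {e : X ⟶ Y} {f : X ⟶ Z} {n : Y ⟶ P} {e' : Z ⟶ P}
    (he : F.im e = ⊤) (sq : IsPushout e f n e') :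
    F.ker e' = κe.app (F.dir f (F.ker e)) := by
  refine le_antisymm ?_ (h.app_e_le ⟨_, e', rfl⟩ ?_)
  · obtain ⟨W, g, hg, hg'⟩ := exists_quotient (h.normalCluster_app (F.dir f (F.ker e)))
    have h₁ : F.ker e ≤ F.ker (f ≫ g) := by
      rw [ker_comp, ← F.gc f, hg']
      exact h.closure_e.le _
    obtain ⟨w, hw⟩ := exists_desc he h₁
    rw [← hg', ← sq.inr_desc w g hw]
    exact ker_le_ker_comp _ _
  · rw [dir_le_ker_iff, ← sq.w]
    exact ker_le_ker_comp _ _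

theorem exists_isPullback {m : X ⟶ Z} (f : Y ⟶ Z) (hm : F.ker m = ⊥) :
    ∃ (P : C) (g : P ⟶ X) (m' : P ⟶ Y), IsPullback g m' m f := by
  obtain ⟨W, n, hn, hn'⟩ := exists_embedding (h.conormalCluster_inv f ⟨X, m, rfl⟩)
  have h₁ : F.im (n ≫ f) ≤ F.im m := by
    rw [im_comp, F.gc f, hn']
  obtain ⟨w, hw⟩ := exists_lift hm h₁
  exact ⟨W, w, n, isPullback_of_inv_eq hm hn hw hn'.ge⟩

theorem exists_isPushout {e : X ⟶ Y} (f : X ⟶ Z) (he : F.im e = ⊤) :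
    ∃ (P : C) (n : Y ⟶ P) (e' : Z ⟶ P), IsPushout e f n e' := by
  obtain ⟨W, g, hg, hg'⟩ := exists_quotient (h.normalCluster_app (F.dir f (F.ker e)))
  have h₁ : F.ker e ≤ F.ker (f ≫ g) := by
    rw [ker_comp, ← F.gc f, hg']
    exact h.closure_e.le _
  obtain ⟨w, hw⟩ := exists_desc he h₁
  refine ⟨W, w, g, isPushout_of_le_ker he hg hw fun g' hg'' => ?_⟩
  rw [hg']
  exact h.app_e_le ⟨_, g', rfl⟩ hg''

/-- Subobjects of `X` correspond to the `κs`-closed clusters in `X`, which form a lattice because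
the closed subform is orean. -/
theorem isBoundedLattice_subobjects (X : C) :
    IsBoundedLattice (F.bicategoryStructure.Subobjects X) := by
  have := h.closure_s.closed_isOrean
  choose D m hm hm' using fun A : κs.closed.Cluster X =>
    exists_embedding (h.app_s_eq_iff.1 (κs.app_inclusion A))
  refine (IsOrean.isBoundedLattice (F := κs.closed) X).of_surjective
    (fun A => toAntisymmetrization (· ≤ ·)
      ⟨D A, m A, bicategoryStructure_left_iff.2 (hm A)⟩) (fun A B => ?_) fun q => ?_
  · rw [toAntisymmetrization_le_toAntisymmetrization_iff, ← κs.inclusion_le_iff, ← hm', ← hm']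
    refine ⟨fun ⟨w, hw⟩ => ?_, fun hAB => exists_lift (hm B) hAB⟩
    exact ((congrArg F.im hw).ge).trans (im_comp_le _ _)
  · induction q using Quotient.inductionOn with | _ q
    obtain ⟨V, n, hn⟩ := q
    have hn' := bicategoryStructure_left_iff.1 hn
    have h₁ : κs.app (F.im n) = F.im n := h.app_s_eq_iff.2 ⟨V, n, rfl⟩
    refine ⟨κs.ofClosed (F.im n) h₁, le_antisymm (exists_lift hn' ?_) (exists_lift (hm _) ?_)⟩
    · exact (hm' (κs.ofClosed (F.im n) h₁)).le
    · exact (hm' (κs.ofClosed (F.im n) h₁)).ge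

theorem isBoundedLattice_quotients (X : C) :
    IsBoundedLattice (F.bicategoryStructure.Quotients X) := by
  have := h.closure_e.closed_isOrean
  choose D e he he' using fun A : κe.closed.Cluster X =>
    exists_quotient (h.app_e_eq_iff.1 (κe.app_inclusion A))
  refine (IsOrean.isBoundedLattice (F := κe.closed) X).of_surjective
    (fun A => toAntisymmetrization (· ≤ ·)
      ⟨D A, e A, bicategoryStructure_right_iff.2 (he A)⟩) (fun A B => ?_) fun q => ?_
  · rw [toAntisymmetrization_le_toAntisymmetrization_iff, ← κe.inclusion_le_iff, ← he', ← he']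
    refine ⟨fun ⟨w, hw⟩ => ?_, fun hAB => exists_desc (he A) hAB⟩
    exact (ker_le_ker_comp _ _).trans (congrArg F.ker hw).le
  · induction q using Quotient.inductionOn with | _ q
    obtain ⟨V, n, hn⟩ := q
    have hn' := bicategoryStructure_right_iff.1 hn
    have h₁ : κe.app (F.ker n) = F.ker n := h.app_e_eq_iff.2 ⟨V, n, rfl⟩
    refine ⟨κe.ofClosed (F.ker n) h₁, le_antisymm (exists_desc (he _) ?_) (exists_desc hn' ?_)⟩
    · exact (he' (κe.ofClosed (F.ker n) h₁)).le
    · exact (he' (κe.ofClosed (F.ker n) h₁)).ge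

/-- The bridge between the pullback squares in (B1), (B2), (B5) and kernels: such a pullback embeds
the conormal closure of the kernel. -/
theorem im_eq_of_isPullback_initial {q : P ⟶ X} {k : P ⟶ Y} {z : X ⟶ Z} {e : Y ⟶ Z}
    (hz : F.bicategoryStructure.IsInitialLeft z) (sq : IsPullback q k z e) :
    F.im k = κs.app (F.ker e) := by
  rw [h.isInitialLeft_iff] at hz
  rw [h.im_eq_of_isPullback hz.1 sq, h.app_s_ker, hz.2]

theorem b0 : F.bicategoryStructure.B0 where
  properFactorizationSystem := isProperFactorizationSystem
  subobjects := h.isBoundedLattice_subobjects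
  quotients := h.isBoundedLattice_quotients
  hasPushout _ f he :=
    have ⟨_, _, _, sq⟩ := h.exists_isPushout f (bicategoryStructure_right_iff.1 he)
    sq.hasPushout
  hasPullback _ f hm :=
    have ⟨_, _, _, sq⟩ := h.exists_isPullback f (bicategoryStructure_left_iff.1 hm)
    sq.hasPullback

theorem b1 : F.bicategoryStructure.B1 where
  pullback_right e' m' m e hm he sq := by
    rw [bicategoryStructure_left_iff] at hm
    rw [bicategoryStructure_right_iff] at he ⊢
    refine dir_injective hm ?_
    rw [← im_comp, sq.w, im_comp, h.im_eq_of_isPullback hm sq, dir_inv_of_im_eq_top he, im]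
  isPullback p a b e k q z t hp ha hb he hk hq hz w ht sq := by
    rw [bicategoryStructure_left_iff] at ha hb
    rw [bicategoryStructure_right_iff] at hp
    refine isPullback_of_inv_eq hb ha w ?_
    have h₁ : F.im b = F.dir e (F.im a) := by
      rw [← im_comp, ← w, im_comp, hp, im]
    -- The inverse image is `im a ⊔ ker e`; the factorization through `a` says that `κs (ker e) ≤ im
    -- a`, which absorbs the kernel.
    rw [h₁, IsNoetherian.inv_dir]
    refine sup_le le_rfl ((h.closure_s.le _).trans ?_)
    rw [← h.im_eq_of_isPullback_initial hz sq, ← ht]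
    exact im_comp_le _ _

theorem b2 : F.bicategoryStructure.B2 := by
  intro K O X Y q k z e hq hk hz he sq
  rw [bicategoryStructure_right_iff] at hq he
  refine isPushout_of_le_ker hq he sq.w fun g hg => ?_
  have h₁ : F.ker q = F.inv k (F.ker e) := by
    rw [← ker_comp, ← sq.w, ker_comp, (h.isInitialLeft_iff.1 hz).1, ker]
  -- The direct image of `ker q` along `k` is `ker e ⊓ κs (ker e) = ker e`.
  rwa [h₁, IsNoetherian.dir_inv, h.im_eq_of_isPullback_initial hz sq,
    inf_eq_left.2 (h.closure_s.le _)] at hg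

theorem b3 : F.bicategoryStructure.B3 := by
  intro O W X Q P z e m n e' hz he hm he' sq
  rw [bicategoryStructure_right_iff] at he
  rw [bicategoryStructure_left_iff] at hm ⊢
  obtain ⟨hz₁, hz₂⟩ := h.isInitialLeft_iff.1 hz
  -- The meet decomposition enters here. With `D = dir m (ker e)`, the inverse image along `e` of
  -- the left side equals that of `κe D ⊓ κs D` along `m`, and the latter meet is below `D`.
  have key : F.ker n ⊓ κs.app ⊥ ≤ ⊥ := by
    have h₁ : F.inv e (F.ker n ⊓ κs.app ⊥) ≤ F.ker e := by
      rw [(F.gc e).u_inf, ← h.app_s_ker, ← ker_comp, sq.w, ker_comp,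
        h.ker_eq_of_isPushout he sq]
      conv_rhs => rw [← inv_dir_of_ker_eq_bot hm (F.ker e)]
      refine le_trans ?_ ((F.gc m).monotone_u (h.inf_le _))
      rw [(F.gc m).u_inf, ← h.dir_app_s, inv_dir_of_ker_eq_bot hm, inf_comm]
    rw [← dir_inv_of_im_eq_top he (_ ⊓ _)]
    exact (F.gc e _ _).2 h₁
  refine dir_injective hz₁ (le_antisymm ?_ ((F.gc z).monotone_l bot_le))
  rw [ker_comp, IsNoetherian.dir_inv, hz₂]
  exact key.trans bot_le

theorem b4 : F.bicategoryStructure.B4 := fun _ => h.leftTrivial_of_rightTrivial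

omit h in
-- The join `ker c ⊔ ker d` is normal. Its quotient factors through `d`, and the induced morphism
-- has kernel `dir d (ker c)`, because both clusters have that join as inverse image along `d`.
theorem normalCluster_dir_ker {c : Z ⟶ X} {d : Z ⟶ Y} (hd : F.im d = ⊤) :
    F.NormalCluster (F.dir d (F.ker c)) := by
  obtain ⟨V, g, hg, hg'⟩ := exists_quotient
    (IsNoetherian.normal_sup (F.ker c) (F.ker d) ⟨_, c, rfl⟩ ⟨_, d, rfl⟩)
  obtain ⟨w, rfl⟩ := exists_desc hd (hg'.symm ▸ le_sup_right : F.ker d ≤ F.ker g)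
  refine ⟨V, w, inv_injective hd ?_⟩
  rw [← ker_comp, hg', IsNoetherian.inv_dir]

theorem b5 : F.bicategoryStructure.B5 := by
  intro K K' O O' X Y Z W q k z c q' k' z' b d a t hq hk hz hc hq' hk' hz' hb hd ha sq sq' po ht
  rw [bicategoryStructure_left_iff] at hk'
  rw [bicategoryStructure_right_iff] at hd hc ⊢
  -- Compared along `k'`, both images are `κs (dir d (ker c))`: normality of `dir d (ker c)` makes
  -- it equal to `ker b`.
  refine dir_injective hk' ?_
  rw [← im_comp, ht, im_comp, ← im, h.im_eq_of_isPullback_initial hz sq,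
    h.im_eq_of_isPullback_initial hz' sq', h.ker_eq_of_isPushout hc po,
    h.app_e_eq_iff.2 (normalCluster_dir_ker hd), h.dir_app_s]

theorem axioms : F.bicategoryStructure.Axioms := ⟨h.b0, h.b1, h.b2, h.b3, h.b4, h.b5⟩

/-- Left triviality makes the conormal closure of `ker p.e` equal to `⊤`, so the left leg of a span
is recovered from its cluster. -/
theorem app_s_dir_ker {p : F.bicategoryStructure.Span X}
    (hp : F.bicategoryStructure.LeftTrivial p.cod) :
    κs.app (F.dir p.m (F.ker p.e)) = F.im p.m := by
  rw [← h.dir_app_s, h.app_s_ker, h.leftTrivial_iff.1 hp, (F.gc p.e).u_top, im]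

/-- An emd-noetherian form is presented by its quotients and embeddings. -/
noncomputable def presents : Presents F.bicategoryStructure F where
  cl p _ := F.dir p.m (F.ker p.e)
  rel_iff f p hp q hq := by
    have hqm := bicategoryStructure_left_iff.1 q.left_m
    constructor
    · intro r
      -- Conormal closures give `w` between the left legs; comparing kernels then gives `s` between
      -- the codomains.
      have h₁ := κs.rel_app r
      rw [h.app_s_dir_ker hp, h.app_s_dir_ker hq, ← dir_le_iff, ← im_comp] at h₁
      obtain ⟨w, hw⟩ := exists_lift hqm h₁
      have h₂ : F.ker p.e ≤ F.ker (w ≫ q.e) := by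
        rw [ker_comp, ← F.gc w, ← inv_dir_of_ker_eq_bot hqm (F.ker q.e), ← F.gc, ← dir_comp, hw,
          dir_comp]
        exact dir_le_iff.2 r
      obtain ⟨s, hs⟩ := exists_desc (bicategoryStructure_right_iff.1 p.right_e) h₂
      exact ⟨w, s, hw, hs.symm⟩
    · rintro ⟨w, s, hw, hs⟩
      rw [← dir_le_iff, ← dir_comp, ← hw, dir_comp]
      refine (F.gc q.m).monotone_l ?_
      rw [F.gc w, ← ker_comp, hs]
      exact ker_le_ker_comp _ _
  exists_cl_eq {X} A := by
    obtain ⟨D, m, hm, hm'⟩ := exists_embedding (h.conormalCluster_app A)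
    -- Below `κs A` the cluster `A` agrees with its normal closure, so its restriction to the domain
    -- of `m` is normal and has a quotient.
    have h₁ : F.inv m (κe.app A) = F.inv m A := by
      refine le_antisymm ?_ ((F.gc m).monotone_u (h.closure_e.le A))
      rw [← F.gc m]
      refine le_trans (le_inf ?_ ?_) (h.inf_le A)
      · rw [← hm']
        exact (F.gc m).monotone_l le_top
      · exact (F.gc m).l_u_le _
    obtain ⟨Q, e, he, he'⟩ := exists_quotient (normalCluster_inv m (h.normalCluster_app A))
    have h₂ : F.dir m (F.ker e) = A := by
      rw [he', h₁, IsNoetherian.dir_inv, hm', inf_eq_left]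
      exact h.closure_s.le A
    refine ⟨⟨D, Q, e, m, bicategoryStructure_right_iff.2 he, bicategoryStructure_left_iff.2 hm⟩,
      ?_, h₂⟩
    rw [h.leftTrivial_iff]
    have h₃ : κs.app (F.ker e) = ⊤ := dir_injective hm (by rw [h.dir_app_s, h₂, ← hm', im])
    rw [← dir_inv_of_im_eq_top he (κs.app ⊥), ← h.app_s_ker, h₃]
    exact he

end IsClosurePair

end FormTheory

/-! ### Calculus of subobjects and quotients under (B0)-(B5) -/

namespace FormTheory

namespace BicategoryStructure

variable {C : Type u} [Category.{v} C] {S : BicategoryStructure C} {W X Y Z P Q : C}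

namespace IsProperFactorizationSystem

variable (h : S.IsProperFactorizationSystem)
include h

theorem right_of_comp {f : X ⟶ Y} {g : Y ⟶ Z} (hfg : S.right (f ≫ g)) : S.right g := by
  obtain ⟨W, e, m, he, hm, rfl⟩ := h.factorization g
  have := h.mono_of_left m hm
  obtain ⟨d, ⟨-, hd⟩, -⟩ := h.diagonal (f ≫ e ≫ m) (𝟙 Z) (f ≫ e) m hfg hm (by simp)
  have : IsSplitEpi m := ⟨⟨d, hd⟩⟩
  have : IsIso m := isIso_of_mono_of_isSplitEpi m
  exact h.right_comp _ _ he (h.right_of_isIso m)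

theorem left_of_comp {f : X ⟶ Y} {g : Y ⟶ Z} (hfg : S.left (f ≫ g)) : S.left f := by
  obtain ⟨W, e, m, he, hm, rfl⟩ := h.factorization f
  have := h.epi_of_right e he
  obtain ⟨d, ⟨hd, -⟩, -⟩ := h.diagonal e (m ≫ g) (𝟙 X) ((e ≫ m) ≫ g) he hfg (by simp)
  have : IsSplitMono e := ⟨⟨d, hd⟩⟩
  have : IsIso e := isIso_of_epi_of_isSplitMono e
  exact h.left_comp _ _ (h.left_of_isIso e) hm

theorem left_of_isPullback {g : P ⟶ X} {m' : P ⟶ Y} {m : X ⟶ Z} {f : Y ⟶ Z}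
    (sq : IsPullback g m' m f) (hm : S.left m) : S.left m' := by
  obtain ⟨W, e, n, he, hn, rfl⟩ := h.factorization m'
  have := h.epi_of_right e he
  have := h.mono_of_left m hm
  obtain ⟨d, ⟨hd, hd'⟩, -⟩ := h.diagonal e (n ≫ f) g m he hm (by simpa using sq.w.symm)
  have h₁ : e ≫ sq.lift d n hd' = 𝟙 P := sq.hom_ext (by simp [hd]) (by simp)
  have : IsSplitMono e := ⟨⟨_, h₁⟩⟩
  have : IsIso e := isIso_of_epi_of_isSplitMono e
  exact h.left_comp _ _ (h.left_of_isIso e) hn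

theorem right_of_isPushout {e : X ⟶ Y} {f : X ⟶ Z} {n : Y ⟶ P} {e' : Z ⟶ P}
    (sq : IsPushout e f n e') (he : S.right e) : S.right e' := by
  obtain ⟨W, d, m, hd, hm, rfl⟩ := h.factorization e'
  have := h.mono_of_left m hm
  obtain ⟨l, ⟨hl, hl'⟩, -⟩ := h.diagonal e n (f ≫ d) m he hm (by simpa using sq.w)
  have h₁ : sq.desc l d hl ≫ m = 𝟙 P := sq.hom_ext (by simp [hl']) (by simp)
  have : IsSplitEpi m := ⟨⟨_, h₁⟩⟩
  have : IsIso m := isIso_of_mono_of_isSplitEpi m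
  exact h.right_comp _ _ hd (h.right_of_isIso m)

end IsProperFactorizationSystem

/-- The subobject represented by a left morphism. -/
def sub (m : X ⟶ Y) (h : S.left m) : S.Subobjects Y := toAntisymmetrization (· ≤ ·) ⟨X, m, h⟩

/-- The quotient represented by a right morphism. -/
def quo (e : X ⟶ Y) (h : S.right e) : S.Quotients X := toAntisymmetrization (· ≤ ·) ⟨Y, e, h⟩

theorem sub_le_sub {m : X ⟶ Z} {n : Y ⟶ Z} {hm : S.left m} {hn : S.left n} :
    sub m hm ≤ sub n hn ↔ ∃ w, w ≫ n = m := Iff.rfl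

theorem quo_le_quo {m : X ⟶ Y} {n : X ⟶ Z} {hm : S.right m} {hn : S.right n} :
    quo m hm ≤ quo n hn ↔ ∃ w, m ≫ w = n := Iff.rfl

theorem exists_sub_eq (A : S.Subobjects X) : ∃ (W : C) (m : W ⟶ X) (h : S.left m), sub m h = A := by
  induction A using Quotient.inductionOn with | _ A
  exact ⟨A.dom, A.hom, A.prop, rfl⟩

theorem exists_quo_eq (E : S.Quotients X) :
    ∃ (W : C) (e : X ⟶ W) (h : S.right e), quo e h = E := by
  induction E using Quotient.inductionOn with | _ E
  exact ⟨E.cod, E.hom, E.prop, rfl⟩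

/-- A morphism restricts to the given subobjects. -/
def SubRel (f : X ⟶ Y) : S.Subobjects X → S.Subobjects Y → Prop :=
  Quotient.lift₂ (fun m n => ∃ w : m.dom ⟶ n.dom, w ≫ n.hom = m.hom ≫ f) (by
    rintro m n m' n' ⟨⟨w₁, h₁⟩, ⟨w₂, h₂⟩⟩ ⟨⟨w₃, h₃⟩, ⟨w₄, h₄⟩⟩
    refine propext ⟨fun ⟨w, hw⟩ => ⟨w₂ ≫ w ≫ w₃, ?_⟩, fun ⟨w, hw⟩ => ⟨w₁ ≫ w ≫ w₄, ?_⟩⟩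
    · rw [Category.assoc, Category.assoc, h₃, hw, ← Category.assoc, h₂]
    · rw [Category.assoc, Category.assoc, h₄, hw, ← Category.assoc, h₁])

/-- A morphism induces a morphism between the given quotients. -/
def QuoRel (f : X ⟶ Y) : S.Quotients X → S.Quotients Y → Prop :=
  Quotient.lift₂ (fun m n => ∃ w : m.cod ⟶ n.cod, m.hom ≫ w = f ≫ n.hom) (by
    rintro m n m' n' ⟨⟨w₁, h₁⟩, ⟨w₂, h₂⟩⟩ ⟨⟨w₃, h₃⟩, ⟨w₄, h₄⟩⟩
    refine propext ⟨fun ⟨w, hw⟩ => ⟨w₂ ≫ w ≫ w₃, ?_⟩, fun ⟨w, hw⟩ => ⟨w₁ ≫ w ≫ w₄, ?_⟩⟩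
    · rw [← Category.assoc, h₂, ← Category.assoc, hw, Category.assoc, h₃]
    · rw [← Category.assoc, h₁, ← Category.assoc, hw, Category.assoc, h₄])

theorem subRel_sub {f : Y ⟶ Z} {m : X ⟶ Y} {n : W ⟶ Z} {hm : S.left m} {hn : S.left n} :
    SubRel f (sub m hm) (sub n hn) ↔ ∃ w, w ≫ n = m ≫ f := Iff.rfl

theorem quoRel_quo {f : X ⟶ Y} {m : X ⟶ Z} {n : Y ⟶ W} {hm : S.right m} {hn : S.right n} :
    QuoRel f (quo m hm) (quo n hn) ↔ ∃ w, m ≫ w = f ≫ n := Iff.rfl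

variable [hS : Fact S.Axioms]

variable (S) in
theorem pfs : S.IsProperFactorizationSystem := hS.out.b0.properFactorizationSystem

/-- The diagonal property makes the left part of a factorization the least subobject receiving `m`.
Dually its right part gives inverse images of quotients; pullbacks and pushouts give the other two
adjoints. -/
theorem subRel_sub_iff_le {f : Y ⟶ Z} {m : X ⟶ Y} {n : W ⟶ Z} {hm : S.left m} {hn : S.left n}
    {e : X ⟶ P} {i : P ⟶ Z} (he : S.right e) (hi : S.left i) (w : e ≫ i = m ≫ f) :
    SubRel f (sub m hm) (sub n hn) ↔ sub i hi ≤ sub n hn := by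
  rw [subRel_sub, sub_le_sub]
  constructor
  · rintro ⟨r, hr⟩
    obtain ⟨d, ⟨-, hd⟩, -⟩ := (pfs S).diagonal e i r n he hn (by rw [w, hr])
    exact ⟨d, hd⟩
  · rintro ⟨r, hr⟩
    exact ⟨e ≫ r, by rw [Category.assoc, hr, w]⟩

theorem quoRel_quo_iff_le {f : X ⟶ Y} {m : X ⟶ Z} {n : Y ⟶ W} {hm : S.right m} {hn : S.right n}
    {e : X ⟶ P} {i : P ⟶ W} (he : S.right e) (hi : S.left i) (w : e ≫ i = f ≫ n) :
    QuoRel f (quo m hm) (quo n hn) ↔ quo m hm ≤ quo e he := by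
  rw [quoRel_quo, quo_le_quo]
  constructor
  · rintro ⟨r, hr⟩
    obtain ⟨d, ⟨hd, -⟩, -⟩ := (pfs S).diagonal m r e i hm hi (by rw [w, hr])
    exact ⟨d, hd⟩
  · rintro ⟨r, hr⟩
    exact ⟨r ≫ i, by rw [← Category.assoc, hr, w]⟩

omit hS in
theorem subRel_sub_iff_le' {f : Y ⟶ Z} {m : X ⟶ Y} {n : W ⟶ Z} {hm : S.left m} {hn : S.left n}
    {g : P ⟶ W} {i : P ⟶ Y} (hi : S.left i) (sq : IsPullback g i n f) :
    SubRel f (sub m hm) (sub n hn) ↔ sub m hm ≤ sub i hi := by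
  rw [subRel_sub, sub_le_sub]
  constructor
  · rintro ⟨r, hr⟩
    exact ⟨sq.lift r m hr, by simp⟩
  · rintro ⟨r, hr⟩
    exact ⟨r ≫ g, by rw [← hr, Category.assoc, sq.w, Category.assoc]⟩

omit hS in
theorem quoRel_quo_iff_le' {f : X ⟶ Y} {m : X ⟶ Z} {n : Y ⟶ W} {hm : S.right m} {hn : S.right n}
    {g : Z ⟶ P} {i : Y ⟶ P} (hi : S.right i) (sq : IsPushout m f g i) :
    QuoRel f (quo m hm) (quo n hn) ↔ quo i hi ≤ quo n hn := by
  rw [quoRel_quo, quo_le_quo]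
  constructor
  · rintro ⟨r, hr⟩
    exact ⟨sq.desc r n hr, by simp⟩
  · rintro ⟨r, hr⟩
    exact ⟨g ≫ r, by rw [← hr, ← Category.assoc, sq.w, Category.assoc]⟩

theorem exists_isPullback {m : X ⟶ Z} (hm : S.left m) (f : Y ⟶ Z) :
    ∃ (P : C) (g : P ⟶ X) (n : P ⟶ Y), S.left n ∧ IsPullback g n m f := by
  have := hS.out.b0.hasPullback m f hm
  exact ⟨_, _, _, (pfs S).left_of_isPullback (IsPullback.of_hasPullback m f) hm,
    IsPullback.of_hasPullback m f⟩

theorem exists_isPushout {e : X ⟶ Y} (he : S.right e) (f : X ⟶ Z) :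
    ∃ (P : C) (g : Y ⟶ P) (n : Z ⟶ P), S.right n ∧ IsPushout e f g n := by
  have := hS.out.b0.hasPushout e f he
  exact ⟨_, _, _, (pfs S).right_of_isPushout (IsPushout.of_hasPushout e f) he,
    IsPushout.of_hasPushout e f⟩

theorem exists_sdir (f : X ⟶ Y) (A : S.Subobjects X) :
    ∃ T : S.Subobjects Y, ∀ B, T ≤ B ↔ SubRel f A B := by
  obtain ⟨W, m, hm, rfl⟩ := exists_sub_eq A
  obtain ⟨V, e, n, he, hn, w⟩ := (pfs S).factorization (m ≫ f)
  refine ⟨sub n hn, fun B => ?_⟩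
  obtain ⟨U, i, hi, rfl⟩ := exists_sub_eq B
  exact (subRel_sub_iff_le he hn w).symm

theorem exists_sinv (f : X ⟶ Y) (B : S.Subobjects Y) :
    ∃ T : S.Subobjects X, ∀ A, A ≤ T ↔ SubRel f A B := by
  obtain ⟨W, m, hm, rfl⟩ := exists_sub_eq B
  obtain ⟨V, g, n, hn, sq⟩ := exists_isPullback hm f
  refine ⟨sub n hn, fun B => ?_⟩
  obtain ⟨U, i, hi, rfl⟩ := exists_sub_eq B
  exact (subRel_sub_iff_le' hn sq).symm

theorem exists_qdir (f : X ⟶ Y) (A : S.Quotients X) :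
    ∃ T : S.Quotients Y, ∀ B, T ≤ B ↔ QuoRel f A B := by
  obtain ⟨W, m, hm, rfl⟩ := exists_quo_eq A
  obtain ⟨V, g, n, hn, sq⟩ := exists_isPushout hm f
  refine ⟨quo n hn, fun B => ?_⟩
  obtain ⟨U, i, hi, rfl⟩ := exists_quo_eq B
  exact (quoRel_quo_iff_le' hn sq).symm

theorem exists_qinv (f : X ⟶ Y) (B : S.Quotients Y) :
    ∃ T : S.Quotients X, ∀ A, A ≤ T ↔ QuoRel f A B := by
  obtain ⟨W, m, hm, rfl⟩ := exists_quo_eq B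
  obtain ⟨V, e, n, he, hn, w⟩ := (pfs S).factorization (f ≫ m)
  refine ⟨quo e he, fun B => ?_⟩
  obtain ⟨U, i, hi, rfl⟩ := exists_quo_eq B
  exact (quoRel_quo_iff_le he hn w).symm

/-- The direct image of a subobject. -/
noncomputable def sdir (f : X ⟶ Y) (A : S.Subobjects X) : S.Subobjects Y :=
  (exists_sdir f A).choose

/-- The inverse image of a subobject. -/
noncomputable def sinv (f : X ⟶ Y) (B : S.Subobjects Y) : S.Subobjects X :=
  (exists_sinv f B).choose

/-- The direct image of a quotient. -/
noncomputable def qdir (f : X ⟶ Y) (E : S.Quotients X) : S.Quotients Y :=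
  (exists_qdir f E).choose

/-- The inverse image of a quotient. -/
noncomputable def qinv (f : X ⟶ Y) (E : S.Quotients Y) : S.Quotients X :=
  (exists_qinv f E).choose

theorem sdir_le_iff {f : X ⟶ Y} {A : S.Subobjects X} {B : S.Subobjects Y} :
    sdir f A ≤ B ↔ SubRel f A B := (exists_sdir f A).choose_spec B

theorem le_sinv_iff {f : X ⟶ Y} {A : S.Subobjects X} {B : S.Subobjects Y} :
    A ≤ sinv f B ↔ SubRel f A B := (exists_sinv f B).choose_spec A

theorem qdir_le_iff {f : X ⟶ Y} {A : S.Quotients X} {B : S.Quotients Y} :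
    qdir f A ≤ B ↔ QuoRel f A B := (exists_qdir f A).choose_spec B

theorem le_qinv_iff {f : X ⟶ Y} {A : S.Quotients X} {B : S.Quotients Y} :
    A ≤ qinv f B ↔ QuoRel f A B := (exists_qinv f B).choose_spec A

variable (S) in
theorem sgc (f : X ⟶ Y) : GaloisConnection (sdir (S := S) f) (sinv f) :=
  fun _ _ => sdir_le_iff.trans le_sinv_iff.symm

variable (S) in
theorem qgc (f : X ⟶ Y) : GaloisConnection (qdir (S := S) f) (qinv f) :=
  fun _ _ => qdir_le_iff.trans le_qinv_iff.symm

theorem sdir_sub {f : Y ⟶ Z} {m : X ⟶ Y} {hm : S.left m}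
    {e : X ⟶ P} {i : P ⟶ Z} (he : S.right e) (hi : S.left i) (w : e ≫ i = m ≫ f) :
    sdir f (sub m hm) = sub i hi := by
  refine eq_of_forall_ge_iff fun B => ?_
  obtain ⟨U, n, hn, rfl⟩ := exists_sub_eq B
  rw [sdir_le_iff, subRel_sub_iff_le he hi w]

theorem sinv_sub {f : Y ⟶ Z} {n : W ⟶ Z} {hn : S.left n} {g : P ⟶ W} {i : P ⟶ Y}
    (hi : S.left i) (sq : IsPullback g i n f) : sinv f (sub n hn) = sub i hi := by
  refine eq_of_forall_le_iff fun B => ?_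
  obtain ⟨U, m, hm, rfl⟩ := exists_sub_eq B
  rw [le_sinv_iff, subRel_sub_iff_le' hi sq]

theorem qinv_quo {f : X ⟶ Y} {n : Y ⟶ W} {hn : S.right n}
    {e : X ⟶ P} {i : P ⟶ W} (he : S.right e) (hi : S.left i) (w : e ≫ i = f ≫ n) :
    qinv f (quo n hn) = quo e he := by
  refine eq_of_forall_le_iff fun B => ?_
  obtain ⟨U, m, hm, rfl⟩ := exists_quo_eq B
  rw [le_qinv_iff, quoRel_quo_iff_le he hi w]

theorem qdir_quo {f : X ⟶ Y} {m : X ⟶ Z} {hm : S.right m} {g : Z ⟶ P} {i : Y ⟶ P}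
    (hi : S.right i) (sq : IsPushout m f g i) : qdir f (quo m hm) = quo i hi := by
  refine eq_of_forall_ge_iff fun B => ?_
  obtain ⟨U, n, hn, rfl⟩ := exists_quo_eq B
  rw [qdir_le_iff, quoRel_quo_iff_le' hi sq]

theorem left_id : S.left (𝟙 X) := (pfs S).left_of_isIso _

theorem right_id : S.right (𝟙 X) := (pfs S).right_of_isIso _

theorem qinv_quo_of_right {e : X ⟶ Y} (he : S.right e) {g : Y ⟶ Z} (hg : S.right g) :
    qinv e (quo g hg) = quo (e ≫ g) ((pfs S).right_comp _ _ he hg) :=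
  qinv_quo _ left_id (Category.comp_id _)

theorem sdir_sub_of_left {m : Y ⟶ Z} (hm : S.left m) {n : X ⟶ Y} (hn : S.left n) :
    sdir m (sub n hn) = sub (n ≫ m) ((pfs S).left_comp _ _ hn hm) :=
  sdir_sub right_id _ (Category.id_comp _)

theorem sdir_comp (f : X ⟶ Y) (g : Y ⟶ Z) (A : S.Subobjects X) :
    sdir (f ≫ g) A = sdir g (sdir f A) := by
  obtain ⟨W, m, hm, rfl⟩ := exists_sub_eq A
  obtain ⟨V, e, n, he, hn, w⟩ := (pfs S).factorization (m ≫ f)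
  obtain ⟨V', e', n', he', hn', w'⟩ := (pfs S).factorization (n ≫ g)
  rw [sdir_sub he hn w, sdir_sub he' hn' w']
  refine sdir_sub ((pfs S).right_comp _ _ he he') hn' ?_
  rw [Category.assoc, w', ← Category.assoc, w, Category.assoc]

theorem sinv_comp (f : X ⟶ Y) (g : Y ⟶ Z) (A : S.Subobjects Z) :
    sinv (f ≫ g) A = sinv f (sinv g A) := by
  refine eq_of_forall_le_iff fun B => ?_
  rw [← sgc S f, ← sgc S g, ← sgc S (f ≫ g), sdir_comp]

theorem qinv_comp (f : X ⟶ Y) (g : Y ⟶ Z) (A : S.Quotients Z) :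
    qinv (f ≫ g) A = qinv f (qinv g A) := by
  obtain ⟨W, m, hm, rfl⟩ := exists_quo_eq A
  obtain ⟨V, e, n, he, hn, w⟩ := (pfs S).factorization (g ≫ m)
  obtain ⟨V', e', n', he', hn', w'⟩ := (pfs S).factorization (f ≫ e)
  rw [qinv_quo he hn w, qinv_quo he' hn' w']
  refine qinv_quo he' ((pfs S).left_comp _ _ hn' hn) ?_
  rw [← Category.assoc, w', Category.assoc, w, Category.assoc]

theorem qdir_comp (f : X ⟶ Y) (g : Y ⟶ Z) (A : S.Quotients X) :
    qdir (f ≫ g) A = qdir g (qdir f A) := by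
  refine eq_of_forall_ge_iff fun B => ?_
  rw [qgc S (f ≫ g), qgc S g, qgc S f, qinv_comp]

theorem sdir_id (A : S.Subobjects X) : sdir (𝟙 X) A = A := by
  obtain ⟨W, m, hm, rfl⟩ := exists_sub_eq A
  exact sdir_sub right_id hm (by simp)

theorem qinv_id (A : S.Quotients X) : qinv (𝟙 X) A = A := by
  obtain ⟨W, m, hm, rfl⟩ := exists_quo_eq A
  exact qinv_quo hm left_id (by simp)

theorem qdir_id (A : S.Quotients X) : qdir (𝟙 X) A = A := by
  refine eq_of_forall_ge_iff fun B => ?_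
  rw [qgc S, qinv_id]

noncomputable instance (X : C) : Lattice (S.Subobjects X) where
  __ := (inferInstance : PartialOrder (S.Subobjects X))
  sup A B := ((hS.out.b0.subobjects X).exists_sup A B).choose
  inf A B := ((hS.out.b0.subobjects X).exists_inf A B).choose
  le_sup_left A B := ((hS.out.b0.subobjects X).exists_sup A B).choose_spec.1 (by simp)
  le_sup_right A B := ((hS.out.b0.subobjects X).exists_sup A B).choose_spec.1 (by simp)
  sup_le A B D hA hB := ((hS.out.b0.subobjects X).exists_sup A B).choose_spec.2
    (by rintro _ (rfl | rfl) <;> assumption)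
  inf_le_left A B := ((hS.out.b0.subobjects X).exists_inf A B).choose_spec.1 (by simp)
  inf_le_right A B := ((hS.out.b0.subobjects X).exists_inf A B).choose_spec.1 (by simp)
  le_inf D A B hA hB := ((hS.out.b0.subobjects X).exists_inf A B).choose_spec.2
    (by rintro _ (rfl | rfl) <;> assumption)

noncomputable instance (X : C) : BoundedOrder (S.Subobjects X) where
  top := (hS.out.b0.subobjects X).exists_top.choose
  le_top := (hS.out.b0.subobjects X).exists_top.choose_spec
  bot := (hS.out.b0.subobjects X).exists_bot.choose
  bot_le := (hS.out.b0.subobjects X).exists_bot.choose_spec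

noncomputable instance (X : C) : Lattice (S.Quotients X) where
  __ := (inferInstance : PartialOrder (S.Quotients X))
  sup A B := ((hS.out.b0.quotients X).exists_sup A B).choose
  inf A B := ((hS.out.b0.quotients X).exists_inf A B).choose
  le_sup_left A B := ((hS.out.b0.quotients X).exists_sup A B).choose_spec.1 (by simp)
  le_sup_right A B := ((hS.out.b0.quotients X).exists_sup A B).choose_spec.1 (by simp)
  sup_le A B D hA hB := ((hS.out.b0.quotients X).exists_sup A B).choose_spec.2
    (by rintro _ (rfl | rfl) <;> assumption)
  inf_le_left A B := ((hS.out.b0.quotients X).exists_inf A B).choose_spec.1 (by simp)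
  inf_le_right A B := ((hS.out.b0.quotients X).exists_inf A B).choose_spec.1 (by simp)
  le_inf D A B hA hB := ((hS.out.b0.quotients X).exists_inf A B).choose_spec.2
    (by rintro _ (rfl | rfl) <;> assumption)

noncomputable instance (X : C) : BoundedOrder (S.Quotients X) where
  top := (hS.out.b0.quotients X).exists_top.choose
  le_top := (hS.out.b0.quotients X).exists_top.choose_spec
  bot := (hS.out.b0.quotients X).exists_bot.choose
  bot_le := (hS.out.b0.quotients X).exists_bot.choose_spec

theorem sub_id : sub (𝟙 X) left_id = (⊤ : S.Subobjects X) := by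
  refine top_unique ?_
  obtain ⟨W, m, hm, h⟩ := exists_sub_eq (⊤ : S.Subobjects X)
  rw [← h]
  exact ⟨m, Category.comp_id m⟩

theorem quo_id : quo (𝟙 X) right_id = (⊥ : S.Quotients X) := by
  refine bot_unique ?_
  obtain ⟨W, m, hm, h⟩ := exists_quo_eq (⊥ : S.Quotients X)
  rw [← h]
  exact ⟨m, Category.id_comp m⟩

theorem isInitialLeft_iff {z : X ⟶ Y} (hz : S.left z) :
    S.IsInitialLeft z ↔ sub z hz = ⊥ := by
  constructor
  · rintro ⟨-, h⟩
    refine bot_unique ?_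
    obtain ⟨W, m, hm, h'⟩ := exists_sub_eq (⊥ : S.Subobjects Y)
    rw [← h']
    exact (h m hm).exists
  · refine fun h => ⟨hz, fun W m hm => ?_⟩
    obtain ⟨w, hw⟩ : sub z hz ≤ sub m hm := h ▸ bot_le
    have := (pfs S).mono_of_left m hm
    exact ⟨w, hw, fun w' hw' => by rw [← cancel_mono m, hw']; exact hw.symm⟩

theorem isTerminalRight_iff {e : X ⟶ Y} (he : S.right e) :
    S.IsTerminalRight e ↔ quo e he = ⊤ := by
  constructor
  · rintro ⟨-, h⟩
    refine top_unique ?_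
    obtain ⟨W, m, hm, h'⟩ := exists_quo_eq (⊤ : S.Quotients X)
    rw [← h']
    exact (h m hm).exists
  · refine fun h => ⟨he, fun W m hm => ?_⟩
    obtain ⟨w, hw⟩ : quo m hm ≤ quo e he := h ▸ le_top
    have := (pfs S).epi_of_right m hm
    exact ⟨w, hw, fun w' hw' => by rw [← cancel_epi m, hw']; exact hw.symm⟩

variable (S) in
theorem exists_isInitialLeft (X : C) : ∃ (O : C) (z : O ⟶ X), S.IsInitialLeft z := by
  obtain ⟨W, m, hm, h⟩ := exists_sub_eq (⊥ : S.Subobjects X)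
  exact ⟨W, m, (isInitialLeft_iff hm).2 h⟩

section Left

variable {m : X ⟶ Y} (hm : S.left m)
include hm

theorem sdir_top_of_left : sdir m ⊤ = sub m hm := by
  rw [← sub_id, sdir_sub_of_left hm]
  simp only [Category.id_comp]

theorem sinv_sdir_of_left (A : S.Subobjects X) : sinv m (sdir m A) = A := by
  obtain ⟨W, a, ha, rfl⟩ := exists_sub_eq A
  refine eq_of_forall_le_iff fun B => ?_
  obtain ⟨V, b, hb, rfl⟩ := exists_sub_eq B
  have := (pfs S).mono_of_left m hm
  rw [sdir_sub_of_left hm, le_sinv_iff, subRel_sub, sub_le_sub]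
  simp only [← Category.assoc, cancel_mono]

theorem exists_sdir_eq {A : S.Subobjects Y} (h : A ≤ sub m hm) :
    ∃ B : S.Subobjects X, sdir m B = A := by
  obtain ⟨W, a, ha, rfl⟩ := exists_sub_eq A
  obtain ⟨w, rfl⟩ := sub_le_sub.1 h
  exact ⟨sub w ((pfs S).left_of_comp ha), sdir_sub_of_left hm _⟩

theorem sdir_sinv_of_left (A : S.Subobjects Y) : sdir m (sinv m A) = A ⊓ sub m hm := by
  refine le_antisymm (le_inf ((sgc S m).l_u_le A) ?_) ?_
  · rw [← sdir_top_of_left hm]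
    exact (sgc S m).monotone_l le_top
  · obtain ⟨B, hB⟩ := exists_sdir_eq hm (inf_le_right : A ⊓ sub m hm ≤ _)
    rw [← hB]
    refine (sgc S m).monotone_l ?_
    rw [← sgc S m, hB]
    exact inf_le_left

theorem sinv_bot_of_left : sinv m (⊥ : S.Subobjects Y) = ⊥ := by
  refine bot_unique ?_
  rw [← sinv_sdir_of_left hm ⊥]
  exact (sgc S m).monotone_u bot_le

end Left

section Right

variable {e : X ⟶ Y} (he : S.right e)
include he

theorem sdir_top_of_right : sdir e (⊤ : S.Subobjects X) = ⊤ := by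
  rw [← sub_id, sdir_sub he left_id (by simp), sub_id]

/-- By the stability part of (B1), the pullback of `A` along `e` maps onto `A` by a right morphism.
-/
theorem sdir_sinv_of_right (A : S.Subobjects Y) : sdir e (sinv e A) = A := by
  obtain ⟨W, a, ha, rfl⟩ := exists_sub_eq A
  obtain ⟨V, g, n, hn, sq⟩ := exists_isPullback ha e
  rw [sinv_sub hn sq]
  exact sdir_sub (hS.out.b1.pullback_right _ _ _ _ ha he sq) ha sq.w

theorem exists_isPullback_initial : ∃ (K O : C) (q : K ⟶ O) (k : K ⟶ X) (z : O ⟶ Y) (hk : S.left k),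
    S.right q ∧ S.IsInitialLeft z ∧ IsPullback q k z e ∧ sinv e ⊥ = sub k hk := by
  obtain ⟨O, z, hz⟩ := exists_isInitialLeft S Y
  obtain ⟨K, q, k, hk, sq⟩ := exists_isPullback hz.1 e
  refine ⟨K, O, q, k, z, hk, hS.out.b1.pullback_right _ _ _ _ hz.1 he sq, hz, sq, ?_⟩
  rw [← (isInitialLeft_iff hz.1).1 hz, sinv_sub hk sq]

/-- The second part of (B1): the square formed by a subobject and its image along `e` is a pullback
once the subobject contains the kernel of `e`. -/
theorem sinv_sdir_of_sinv_bot_le {A : S.Subobjects X} (h : sinv e ⊥ ≤ A) :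
    sinv e (sdir e A) = A := by
  obtain ⟨W, a, ha, rfl⟩ := exists_sub_eq A
  obtain ⟨V, p, b, hp, hb, w⟩ := (pfs S).factorization (a ≫ e)
  obtain ⟨K, O, q, k, z, hk, hq, hz, sq, hs⟩ := exists_isPullback_initial he
  rw [hs] at h
  obtain ⟨t, ht⟩ := h
  rw [sdir_sub hp hb w]
  exact sinv_sub ha (hS.out.b1.isPullback p a b e k q z t hp ha hb he hk hq hz w ht sq)

theorem sinv_sdir_of_right (A : S.Subobjects X) : sinv e (sdir e A) = A ⊔ sinv e ⊥ := by
  refine le_antisymm ?_ (sup_le ((sgc S e).le_u_l A) ((sgc S e).monotone_u bot_le))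
  rw [← sinv_sdir_of_sinv_bot_le he (le_sup_right : _ ≤ A ⊔ sinv e ⊥)]
  exact (sgc S e).monotone_u ((sgc S e).monotone_l le_sup_left)

theorem qinv_bot_of_right : qinv e ⊥ = quo e he := by
  rw [← quo_id, qinv_quo_of_right he]
  simp only [Category.comp_id]

theorem qdir_qinv_of_right (E : S.Quotients Y) : qdir e (qinv e E) = E := by
  obtain ⟨W, g, hg, rfl⟩ := exists_quo_eq E
  refine eq_of_forall_ge_iff fun B => ?_
  obtain ⟨V, b, hb, rfl⟩ := exists_quo_eq B
  have := (pfs S).epi_of_right e he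
  rw [qinv_quo_of_right he, qdir_le_iff, quoRel_quo, quo_le_quo]
  simp only [Category.assoc, cancel_epi]

theorem qinv_qdir_of_right (E : S.Quotients X) : qinv e (qdir e E) = E ⊔ quo e he := by
  refine le_antisymm ?_ (sup_le ((qgc S e).le_u_l E) ?_)
  · obtain ⟨W, g, hg, h⟩ := exists_quo_eq (E ⊔ quo e he)
    obtain ⟨w, rfl⟩ := quo_le_quo.1 (h ▸ le_sup_right : quo e he ≤ quo g hg)
    rw [← h, ← qinv_quo_of_right he ((pfs S).right_of_comp hg)]
    refine (qgc S e).monotone_u ?_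
    rw [qgc S e, qinv_quo_of_right he, h]
    exact le_sup_left
  · rw [← qinv_bot_of_right he]
    exact (qgc S e).monotone_u bot_le

end Right

theorem qinv_bot {e : X ⟶ Y} {m : Y ⟶ Z} (he : S.right e) (hm : S.left m) :
    qinv (e ≫ m) ⊥ = quo e he := by
  rw [← quo_id]
  exact qinv_quo he hm (by simp)

theorem sinv_bot {e : X ⟶ Y} {m : Y ⟶ Z} (hm : S.left m) :
    sinv (e ≫ m) (⊥ : S.Subobjects Z) = sinv e ⊥ := by
  rw [sinv_comp, sinv_bot_of_left hm]

/-- The kernel of a quotient, as a subobject. -/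
noncomputable def kerSub : S.Quotients X → S.Subobjects X :=
  Quotient.lift (fun e => sinv e.hom ⊥) (by
    have key : ∀ e e' : S.RightUnder X, e ≤ e' → sinv e.hom (⊥ : S.Subobjects _) ≤ sinv e'.hom ⊥ := by
      rintro e e' ⟨w, hw⟩
      rw [← hw, sinv_comp]
      exact (sgc S e.hom).monotone_u bot_le
    exact fun e e' h => le_antisymm (key _ _ h.1) (key _ _ h.2))

theorem kerSub_quo {e : X ⟶ Y} (he : S.right e) : kerSub (quo e he) = sinv e ⊥ := rfl

theorem kerSub_mono : Monotone (kerSub (S := S) (X := X)) := by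
  intro E E' h
  obtain ⟨W, e, he, rfl⟩ := exists_quo_eq E
  obtain ⟨W', e', he', rfl⟩ := exists_quo_eq E'
  obtain ⟨w, rfl⟩ := quo_le_quo.1 h
  rw [kerSub_quo, kerSub_quo, sinv_comp]
  exact (sgc S e).monotone_u bot_le

/-- The left part of the factorization of `f ≫ g` does not change the inverse image of `⊥`. -/
theorem kerSub_qinv (f : X ⟶ Y) (E : S.Quotients Y) : kerSub (qinv f E) = sinv f (kerSub E) := by
  obtain ⟨W, g, hg, rfl⟩ := exists_quo_eq E
  obtain ⟨V, e, n, he, hn, w⟩ := (pfs S).factorization (f ≫ g)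
  rw [qinv_quo he hn w, kerSub_quo, kerSub_quo, ← sinv_comp, ← w, sinv_bot hn]

theorem sdir_kerSub_le (f : X ⟶ Y) (E : S.Quotients X) :
    sdir f (kerSub E) ≤ kerSub (qdir f E) := by
  rw [sgc S f, ← kerSub_qinv]
  exact kerSub_mono ((qgc S f).le_u_l E)

theorem leftTrivial_iff : S.LeftTrivial X ↔ (⊥ : S.Subobjects X) = ⊤ := by
  constructor
  · rintro ⟨Y, z, hz⟩
    rw [← sinv_bot_of_left hz.1, ← (isInitialLeft_iff hz.1).1 hz, ← sdir_top_of_left,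
      sinv_sdir_of_left hz.1]
  · intro h
    exact ⟨X, 𝟙 X, (isInitialLeft_iff left_id).2 (by rw [sub_id, h])⟩

theorem kerSub_quo_eq_top_iff {e : X ⟶ Y} (he : S.right e) :
    kerSub (quo e he) = ⊤ ↔ S.LeftTrivial Y := by
  rw [leftTrivial_iff, kerSub_quo]
  refine ⟨fun h => ?_, fun h => by rw [h, (sgc S e).u_top]⟩
  rw [← sdir_sinv_of_right he ⊥, h, sdir_top_of_right he]

/-- (B4) in lattice form. -/
theorem kerSub_top : kerSub (⊤ : S.Quotients X) = ⊤ := by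
  obtain ⟨W, e, he, h⟩ := exists_quo_eq (⊤ : S.Quotients X)
  rw [← h, kerSub_quo_eq_top_iff]
  exact hS.out.b4 _ ⟨X, e, (isTerminalRight_iff he).2 h⟩

theorem isInitialLeft_id (h : S.LeftTrivial X) : S.IsInitialLeft (𝟙 X) := by
  rw [leftTrivial_iff] at h
  exact (isInitialLeft_iff left_id).2 (by rw [sub_id, h])

/-- (B3) with the identity of the left trivial object `Y` as initial left morphism. -/
theorem left_of_isPushout {e : X ⟶ Y} {m : X ⟶ Z} {n : Y ⟶ P} {e' : Z ⟶ P} (he : S.right e)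
    (hm : S.left m) (hY : S.LeftTrivial Y) (sq : IsPushout e m n e') : S.left n := by
  simpa using hS.out.b3 _ e m n e' (isInitialLeft_id hY) he hm
    ((pfs S).right_of_isPushout sq he) sq

/-- (B3) in lattice form: since `n` is left, the pushout square exhibits `e ≫ n` as the
factorization of `m ≫ e'`, so no information is lost. -/
theorem qinv_qdir_of_left {m : X ⟶ Y} (hm : S.left m) {N : S.Quotients X} (hN : kerSub N = ⊤) :
    qinv m (qdir m N) = N := by
  obtain ⟨W, e, he, rfl⟩ := exists_quo_eq N
  rw [kerSub_quo_eq_top_iff] at hN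
  obtain ⟨V, n, e', he', sq⟩ := exists_isPushout he m
  rw [qdir_quo he' sq]
  exact qinv_quo he (left_of_isPushout he hm hN sq) sq.w

/-- (B5) in lattice form. The join is the diagonal of the pushout of `c` and `d`, and `t` being
right says that `d` carries the kernel of `c` onto the kernel of `b`. -/
theorem kerSub_sup (E E' : S.Quotients X) : kerSub (E ⊔ E') = kerSub E ⊔ kerSub E' := by
  obtain ⟨V, c, hc, rfl⟩ := exists_quo_eq E
  obtain ⟨W, d, hd, rfl⟩ := exists_quo_eq E'
  obtain ⟨U, a, b, hb, po⟩ := exists_isPushout hc d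
  have ha := (pfs S).right_of_isPushout po.flip hd
  obtain ⟨K, O, q, k, z, hk, hq, hz, sq, hs⟩ := exists_isPullback_initial hc
  obtain ⟨K', O', q', k', z', hk', hq', hz', sq', hs'⟩ := exists_isPullback_initial hb
  have h₁ : sub k hk ≤ sinv d (sub k' hk') := by
    rw [← hs, ← hs', ← kerSub_quo hc, ← kerSub_quo hb, ← sgc S, ← qdir_quo hb po]
    exact sdir_kerSub_le d _
  obtain ⟨t, ht⟩ := subRel_sub.1 (le_sinv_iff.1 h₁)
  have h₂ := hS.out.b5 q k z c q' k' z' b d a t hq hk hz hc hq' hk' hz' hb hd ha sq sq' po ht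
  rw [← qinv_qdir_of_right hd, kerSub_qinv, qdir_quo hb po, kerSub_quo, kerSub_quo, kerSub_quo,
    hs', hs, ← sdir_sub h₂ hk' ht, sinv_sdir_of_right hd]

/-- Restriction of a quotient along a subobject, followed by its direct image. -/
noncomputable def coreflect (A : S.Subobjects X) (E : S.Quotients X) : S.Quotients X :=
  Quotient.lift (fun m : S.LeftOver X => qdir m.hom (qinv m.hom E)) (by
    have key : ∀ m m' : S.LeftOver X, m ≤ m' →
        qdir m.hom (qinv m.hom E) ≤ qdir m'.hom (qinv m'.hom E) := by
      rintro m m' ⟨w, hw⟩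
      rw [← hw, qinv_comp, qdir_comp]
      exact (qgc S _).monotone_l ((qgc S w).l_u_le _)
    exact fun e e' h => le_antisymm (key _ _ h.1) (key _ _ h.2)) A

theorem coreflect_sub {m : X ⟶ Y} (hm : S.left m) (E : S.Quotients Y) :
    coreflect (sub m hm) E = qdir m (qinv m E) := rfl

theorem coreflect_mono {A A' : S.Subobjects X} {E E' : S.Quotients X} (h : A ≤ A') (h' : E ≤ E') :
    coreflect A E ≤ coreflect A' E' := by
  obtain ⟨W, m, hm, rfl⟩ := exists_sub_eq A
  obtain ⟨W', m', hm', rfl⟩ := exists_sub_eq A'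
  obtain ⟨w, rfl⟩ := sub_le_sub.1 h
  rw [coreflect_sub, coreflect_sub, qinv_comp, qdir_comp]
  exact (qgc S m').monotone_l (((qgc S w).l_u_le _).trans ((qgc S m').monotone_u h'))

theorem coreflect_le (A : S.Subobjects X) (E : S.Quotients X) : coreflect A E ≤ E := by
  obtain ⟨W, m, hm, rfl⟩ := exists_sub_eq A
  exact (qgc S m).l_u_le E

/-- For fixed `B`, restricting and pushing forward is an idempotent interior operator, so first
passing through a larger subobject loses nothing. -/
theorem coreflect_coreflect {A B : S.Subobjects X} (h : B ≤ A) (E : S.Quotients X) :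
    coreflect B (coreflect A E) = coreflect B E := by
  refine le_antisymm (coreflect_mono le_rfl (coreflect_le A E)) ?_
  have h₁ : coreflect B (coreflect B E) = coreflect B E := by
    obtain ⟨W, m, hm, rfl⟩ := exists_sub_eq B
    simp only [coreflect_sub, (qgc S m).u_l_u_eq_u]
  rw [← h₁]
  exact coreflect_mono le_rfl (coreflect_mono h le_rfl)

theorem coreflect_top_left (E : S.Quotients X) : coreflect ⊤ E = E := by
  rw [← sub_id, coreflect_sub, qinv_id, qdir_id]

/-- (B2) in lattice form: a quotient is generated by its restriction to its kernel. -/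
theorem coreflect_kerSub (E : S.Quotients X) : coreflect (kerSub E) E = E := by
  obtain ⟨W, e, he, rfl⟩ := exists_quo_eq E
  obtain ⟨K, O, q, k, z, hk, hq, hz, sq, hs⟩ := exists_isPullback_initial he
  rw [kerSub_quo, hs, coreflect_sub, qinv_quo hq hz.1 sq.w]
  exact qdir_quo he (hS.out.b2 q k z e hq hk hz he sq)

/-- The pairs of a subobject and a quotient that represent clusters. -/
def Admissible (A : S.Subobjects X) (E : S.Quotients X) : Prop :=
  A ≤ kerSub E ∧ E ≤ coreflect A E

namespace Admissible

variable {A A' : S.Subobjects X} {E E' : S.Quotients X}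

theorem coreflect_eq (h : Admissible A E) : coreflect A E = E := le_antisymm (coreflect_le A E) h.2

theorem kerSub_qinv_eq_top {m : Y ⟶ X} {hm : S.left m} (h : sub m hm ≤ kerSub E) :
    kerSub (qinv m E) = ⊤ := by
  rw [kerSub_qinv, eq_top_iff, ← sgc S, sdir_top_of_left hm]
  exact h

/-- The restriction of `E` to `A` has kernel `⊤`, and pushing it forward keeps `A` inside the
kernel. This supplies the largest admissible second component below `E`. -/
theorem of_le_kerSub (h : A ≤ kerSub E) : Admissible A (coreflect A E) := by
  refine ⟨?_, (coreflect_coreflect le_rfl E).ge⟩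
  obtain ⟨W, m, hm, rfl⟩ := exists_sub_eq A
  rw [coreflect_sub]
  refine le_trans ?_ (sdir_kerSub_le m _)
  rw [kerSub_qinv_eq_top h, sdir_top_of_left hm]

theorem kerSub (E : S.Quotients X) : Admissible (kerSub E) E := ⟨le_rfl, (coreflect_kerSub E).ge⟩

theorem top : Admissible (⊤ : S.Subobjects X) ⊤ :=
  ⟨kerSub_top.ge, (coreflect_top_left ⊤).ge⟩

theorem bot : Admissible (⊥ : S.Subobjects X) ⊥ := ⟨bot_le, bot_le⟩

theorem coreflect_top (A : S.Subobjects X) : Admissible A (coreflect A ⊤) :=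
  of_le_kerSub (le_top.trans kerSub_top.ge)

theorem sup (h : Admissible A E) (h' : Admissible A' E') : Admissible (A ⊔ A') (E ⊔ E') :=
  ⟨sup_le (h.1.trans (kerSub_mono le_sup_left)) (h'.1.trans (kerSub_mono le_sup_right)),
    sup_le (h.2.trans (coreflect_mono le_sup_left le_sup_left))
      (h'.2.trans (coreflect_mono le_sup_right le_sup_right))⟩

/-- If `E` is pushed forward from `A`, then its direct image is pushed forward from the image of
`A`, through the factorization of `m ≫ f`. Hence direct images need no coreflection. -/
theorem dir (h : Admissible A E) (f : X ⟶ Y) : Admissible (sdir f A) (qdir f E) := by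
  refine ⟨((sgc S f).monotone_l h.1).trans (sdir_kerSub_le f E), ?_⟩
  obtain ⟨W, m, hm, rfl⟩ := exists_sub_eq A
  obtain ⟨V, p, n, hp, hn, w⟩ := (pfs S).factorization (m ≫ f)
  refine ((qgc S f).monotone_l h.2).trans ?_
  rw [sdir_sub hp hn w, coreflect_sub, coreflect_sub, ← qdir_comp, ← w, qdir_comp]
  refine (qgc S n).monotone_l ?_
  rw [← qgc S n, ← qdir_comp, w, qdir_comp]
  exact (qgc S f).monotone_l ((qgc S m).l_u_le E)

end Admissible

end BicategoryStructure

end FormTheory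

/-! ### From bicategory structures to forms: clusters as admissible pairs -/

namespace FormTheory

open Form BicategoryStructure

namespace BicategoryStructure

variable {C : Type u} [Category.{v} C] {S : BicategoryStructure C} [Fact S.Axioms] {X Y : C}

theorem isIso_of_sub_eq_top {m : X ⟶ Y} {hm : S.left m} (h : sub m hm = ⊤) : IsIso m := by
  obtain ⟨w, hw⟩ : sub (𝟙 Y) left_id ≤ sub m hm := by rw [h, sub_id]
  have := (pfs S).mono_of_left m hm
  have : IsSplitEpi m := ⟨⟨w, hw⟩⟩
  exact isIso_of_mono_of_isSplitEpi m

theorem isIso_of_quo_eq_bot {e : X ⟶ Y} {he : S.right e} (h : quo e he = ⊥) : IsIso e := by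
  obtain ⟨w, hw⟩ : quo e he ≤ quo (𝟙 X) right_id := by rw [h, quo_id]
  have := (pfs S).epi_of_right e he
  have : IsSplitMono e := ⟨⟨w, hw⟩⟩
  exact isIso_of_epi_of_isSplitMono e

/-- Admissibility writes `E` as a pushforward along some `j` of a quotient with kernel `⊤`; (B3)
then applies to the composite `j ≫ m`. -/
theorem Admissible.coreflect_qinv_qdir {m : X ⟶ Y} (hm : S.left m) {A : S.Subobjects X}
    {E : S.Quotients X} (h : Admissible A E) : coreflect A (qinv m (qdir m E)) = E := by
  obtain ⟨W, j, hj, rfl⟩ := exists_sub_eq A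
  have h₁ := h.coreflect_eq
  rw [coreflect_sub] at h₁
  conv_lhs => rw [← h₁]
  rw [coreflect_sub, ← qinv_comp, ← qdir_comp, qinv_qdir_of_left ((pfs S).left_comp _ _ hj hm) (Admissible.kerSub_qinv_eq_top h.1), h₁]

theorem qdir_coreflect_of_left {m : X ⟶ Y} (hm : S.left m) (A : S.Subobjects Y)
    (E : S.Quotients Y) : qdir m (coreflect (sinv m A) (qinv m E)) =
      coreflect (A ⊓ sub m hm) E := by
  rw [← sdir_sinv_of_left hm]
  obtain ⟨W, j, hj, h⟩ := exists_sub_eq (sinv m A)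
  rw [← h, sdir_sub_of_left hm, coreflect_sub, coreflect_sub, qdir_comp, qinv_comp]

theorem qdir_coreflect_of_right {e : X ⟶ Y} (he : S.right e) (A : S.Subobjects Y)
    (E : S.Quotients Y) : qdir e (coreflect (sinv e A) (qinv e E)) = coreflect A E := by
  obtain ⟨W, a, ha, rfl⟩ := exists_sub_eq A
  obtain ⟨V, g, n, hn, sq⟩ := exists_isPullback ha e
  have hg := (Fact.out : S.Axioms).b1.pullback_right _ _ _ _ ha he sq
  rw [sinv_sub hn sq, coreflect_sub, coreflect_sub, ← qinv_comp, ← qdir_comp, ← sq.w, qinv_comp,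
    qdir_comp, qdir_qinv_of_right hg]

theorem qdir_coreflect_top_le (f : X ⟶ Y) (A : S.Subobjects X) :
    qdir f (coreflect A ⊤) ≤ coreflect (sdir f A) ⊤ :=
  ((Admissible.coreflect_top A).dir f).2.trans (coreflect_mono le_rfl le_top)

/-- The second component of the compatibility of conormal closure with kernels, needed for `B = ⊥`.
-/
theorem coreflect_sinv_qinv_top (f : X ⟶ Y) (B : S.Subobjects Y) :
    coreflect (sinv f B) (qinv f (coreflect B ⊤)) = coreflect (sinv f B) ⊤ := by
  refine le_antisymm (coreflect_mono le_rfl le_top) ?_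
  rw [← coreflect_coreflect (le_refl (sinv f B)) ⊤]
  refine coreflect_mono le_rfl ?_
  rw [← qgc S f]
  exact (qdir_coreflect_top_le f _).trans (coreflect_mono ((sgc S f).l_u_le B) le_rfl)

/-- Left triviality of the target codomain allows the quotient to be recovered from its direct image
along the left leg, so the second inequality produces the morphism between codomains. -/
theorem span_rel_iff {f : X ⟶ Y} {p : S.Span X} {p' : S.Span Y} (h : S.LeftTrivial p'.cod) :
    p.Rel f p' ↔ sdir f (sub p.m p.left_m) ≤ sub p'.m p'.left_m ∧
      qdir f (qdir p.m (quo p.e p.right_e)) ≤ qdir p'.m (quo p'.e p'.right_e) := by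
  constructor
  · rintro ⟨w, s, h₁, h₂⟩
    refine ⟨sdir_le_iff.2 ⟨w, h₁⟩, ?_⟩
    rw [← qdir_comp, ← h₁, qdir_comp]
    exact (qgc S _).monotone_l (qdir_le_iff.2 ⟨s, h₂.symm⟩)
  · rintro ⟨h₁, h₂⟩
    obtain ⟨w, hw⟩ := subRel_sub.1 (sdir_le_iff.1 h₁)
    rw [← qdir_comp, ← hw, qdir_comp, qgc S,
      qinv_qdir_of_left p'.left_m ((kerSub_quo_eq_top_iff _).2 h), qdir_le_iff] at h₂
    obtain ⟨s, hs⟩ := quoRel_quo.1 h₂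
    exact ⟨w, s, hw, hs.symm⟩

end BicategoryStructure

variable {C : Type u} [Category.{v} C]

/-- A form whose clusters correspond to the admissible pairs of a bicategory structure. -/
structure PairPresentation (S : BicategoryStructure C) [Fact S.Axioms] (F : Form C) where
  s : ∀ {X : C}, F.Cluster X → S.Subobjects X
  q : ∀ {X : C}, F.Cluster X → S.Quotients X
  adm : ∀ {X : C} (A : F.Cluster X), Admissible (s A) (q A)
  rel_iff : ∀ {X Y : C} (f : X ⟶ Y) (A : F.Cluster X) (B : F.Cluster Y),
    F.Rel f A B ↔ sdir f (s A) ≤ s B ∧ qdir f (q A) ≤ q B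
  exists_eq : ∀ {X : C} {A : S.Subobjects X} {E : S.Quotients X}, Admissible A E →
    ∃ T : F.Cluster X, s T = A ∧ q T = E

theorem Presents.nonempty_pairPresentation {S : BicategoryStructure C} [Fact S.Axioms] {F : Form C}
    (hF : Presents S F) : Nonempty (PairPresentation S F) := by
  choose p hp hpA using fun (X : C) => hF.exists_cl_eq (X := X)
  refine ⟨⟨fun {X} A => sub (p X A).m (p X A).left_m,
    fun {X} A => qdir (p X A).m (quo (p X A).e (p X A).right_e), fun {X} A => ?_,
    fun {X Y} f A B => ?_, fun {X A E} h => ?_⟩⟩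
  · have h₁ := (kerSub_quo_eq_top_iff (p X A).right_e).2 (hp X A)
    refine ⟨?_, ?_⟩
    · rw [← sdir_top_of_left, ← h₁]
      exact sdir_kerSub_le _ _
    · rw [coreflect_sub, qinv_qdir_of_left (p X A).left_m h₁]
  · rw [← span_rel_iff (hp Y B), ← hF.rel_iff f _ (hp X A) _ (hp Y B), hpA, hpA]
  -- The span realizing `(A, E)` is the restriction of `E` to `A`: the kernel condition makes its
  -- codomain left trivial, and the second condition recovers `E`.
  · obtain ⟨W, m, hm, rfl⟩ := exists_sub_eq A
    obtain ⟨V, e, he, hE⟩ := exists_quo_eq (qinv m E)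
    have hV : S.LeftTrivial V := by
      rw [← kerSub_quo_eq_top_iff he, hE, Admissible.kerSub_qinv_eq_top h.1]
    let r : S.Span X := ⟨W, V, e, m, he, hm⟩
    have h₁ := (hF.rel_iff (𝟙 X) _ (hp X (hF.cl r hV)) r hV).1
      (by rw [hpA]; exact le_refl (hF.cl r hV))
    have h₂ := (hF.rel_iff (𝟙 X) r hV _ (hp X (hF.cl r hV))).1
      (by rw [hpA]; exact le_refl (hF.cl r hV))
    rw [span_rel_iff hV, sdir_id, qdir_id] at h₁
    rw [span_rel_iff (hp X _), sdir_id, qdir_id] at h₂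
    refine ⟨hF.cl r hV, le_antisymm h₁.1 h₂.1, (le_antisymm h₁.2 h₂.2).trans ?_⟩
    rw [hE]
    exact h.coreflect_eq

namespace PairPresentation

variable {S : BicategoryStructure C} [Fact S.Axioms] {F : Form C} (h : PairPresentation S F)
  {X Y Z : C}

theorem le_iff {A B : F.Cluster X} : A ≤ B ↔ h.s A ≤ h.s B ∧ h.q A ≤ h.q B := by
  rw [le_iff_rel, h.rel_iff, sdir_id, qdir_id]

include h in
theorem ext {A B : F.Cluster X} (hs : h.s A = h.s B) (hq : h.q A = h.q B) : A = B :=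
  le_antisymm (h.le_iff.2 ⟨hs.le, hq.le⟩) (h.le_iff.2 ⟨hs.ge, hq.ge⟩)

/-- The cluster corresponding to an admissible pair. -/
noncomputable def ofPair {A : S.Subobjects X} {E : S.Quotients X} (hA : Admissible A E) :
    F.Cluster X := (h.exists_eq hA).choose

@[simp]
theorem s_ofPair {A : S.Subobjects X} {E : S.Quotients X} (hA : Admissible A E) : h.s (h.ofPair hA) = A :=
  (h.exists_eq hA).choose_spec.1

@[simp]
theorem q_ofPair {A : S.Subobjects X} {E : S.Quotients X} (hA : Admissible A E) : h.q (h.ofPair hA) = E :=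
  (h.exists_eq hA).choose_spec.2

/-- The largest cluster below an arbitrary pair. -/
noncomputable def ofPairLE (A : S.Subobjects X) (E : S.Quotients X) : F.Cluster X :=
  h.ofPair (A := A ⊓ kerSub E) (.of_le_kerSub inf_le_right)

theorem le_ofPairLE_iff {A : S.Subobjects X} {E : S.Quotients X} {T : F.Cluster X} :
    T ≤ h.ofPairLE A E ↔ h.s T ≤ A ∧ h.q T ≤ E := by
  rw [le_iff h, ofPairLE, s_ofPair, q_ofPair]
  refine ⟨fun ⟨h₁, h₂⟩ => ⟨h₁.trans inf_le_left, h₂.trans (coreflect_le _ _)⟩, fun ⟨h₁, h₂⟩ => ?_⟩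
  have h₃ := le_inf h₁ ((h.adm T).1.trans (kerSub_mono h₂))
  exact ⟨h₃, (h.adm T).2.trans (coreflect_mono h₃ h₂)⟩

-- Joins and direct images are componentwise; for meets and inverse images the componentwise pair is
-- replaced by the largest admissible pair below it.
include h in
theorem isOrean : F.IsOrean where
  isBoundedLattice X :=
    { exists_top := ⟨h.ofPair .top, fun A => h.le_iff.2 ⟨by simp, by simp⟩⟩
      exists_bot := ⟨h.ofPair .bot, fun A => h.le_iff.2 ⟨by simp, by simp⟩⟩
      exists_sup := fun A B => by
        refine ⟨h.ofPair ((h.adm A).sup (h.adm B)), ?_, fun D hD => ?_⟩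
        · rintro _ (rfl | rfl) <;> exact h.le_iff.2 ⟨by simp, by simp⟩
        · have h₁ := h.le_iff.1 (hD (by simp : A ∈ _))
          have h₂ := h.le_iff.1 (hD (by simp : B ∈ _))
          rw [h.le_iff, s_ofPair, q_ofPair]
          exact ⟨sup_le h₁.1 h₂.1, sup_le h₁.2 h₂.2⟩
      exists_inf := fun A B => by
        have h₀ := h.le_ofPairLE_iff.1 (le_refl (h.ofPairLE (h.s A ⊓ h.s B) (h.q A ⊓ h.q B)))
        refine ⟨h.ofPairLE (h.s A ⊓ h.s B) (h.q A ⊓ h.q B), ?_, fun D hD => ?_⟩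
        · rintro _ (rfl | rfl)
          · exact h.le_iff.2 ⟨h₀.1.trans inf_le_left, h₀.2.trans inf_le_left⟩
          · exact h.le_iff.2 ⟨h₀.1.trans inf_le_right, h₀.2.trans inf_le_right⟩
        · have h₁ := h.le_iff.1 (hD (by simp : A ∈ _))
          have h₂ := h.le_iff.1 (hD (by simp : B ∈ _))
          rw [h.le_ofPairLE_iff]
          exact ⟨le_inf h₁.1 h₂.1, le_inf h₁.2 h₂.2⟩ }
  exists_of_rel_comp f g A D r := by
    refine ⟨h.ofPair ((h.adm A).dir f), ?_, ?_⟩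
    · rw [h.rel_iff, s_ofPair, q_ofPair]
      exact ⟨le_rfl, le_rfl⟩
    · rw [h.rel_iff, s_ofPair, q_ofPair, ← sdir_comp, ← qdir_comp]
      exact (h.rel_iff _ _ _).1 r
  exists_dir f A := by
    refine ⟨h.ofPair ((h.adm A).dir f), ?_, fun B hB => ?_⟩
    · rw [Set.mem_ofPred_eq, h.rel_iff, s_ofPair, q_ofPair]
      exact ⟨le_rfl, le_rfl⟩
    · rw [h.le_iff, s_ofPair, q_ofPair]
      exact (h.rel_iff _ _ _).1 hB
  exists_inv f T := by
    have h₀ : ∀ A, A ≤ h.ofPairLE (sinv f (h.s T)) (qinv f (h.q T)) ↔ F.Rel f A T := fun A => by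
      rw [h.le_ofPairLE_iff, h.rel_iff, sgc S f, qgc S f]
    exact ⟨_, (h₀ _).1 le_rfl, fun A hA => (h₀ _).2 hA⟩

section Orean

variable [F.IsOrean]

theorem ofPair_eq_dir (f : X ⟶ Y) (A : F.Cluster X) : h.ofPair ((h.adm A).dir f) = F.dir f A := by
  refine eq_of_forall_ge_iff fun B => ?_
  rw [dir_le_iff, h.rel_iff, h.le_iff, s_ofPair, q_ofPair]

theorem ofPair_eq_sup (A B : F.Cluster X) : h.ofPair ((h.adm A).sup (h.adm B)) = A ⊔ B := by
  refine eq_of_forall_ge_iff fun D => ?_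
  rw [sup_le_iff, h.le_iff, h.le_iff, h.le_iff, s_ofPair, q_ofPair, sup_le_iff, sup_le_iff]
  tauto

theorem ofPairLE_eq_inv (f : X ⟶ Y) (T : F.Cluster Y) :
    h.ofPairLE (sinv f (h.s T)) (qinv f (h.q T)) = F.inv f T := by
  refine eq_of_forall_le_iff fun A => ?_
  rw [le_inv_iff, h.le_ofPairLE_iff, h.rel_iff, sgc S f, qgc S f]

@[simp]
theorem s_dir (f : X ⟶ Y) (A : F.Cluster X) : h.s (F.dir f A) = sdir f (h.s A) := by
  rw [← ofPair_eq_dir h, s_ofPair]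

@[simp]
theorem q_dir (f : X ⟶ Y) (A : F.Cluster X) : h.q (F.dir f A) = qdir f (h.q A) := by
  rw [← ofPair_eq_dir h, q_ofPair]

@[simp]
theorem s_sup (A B : F.Cluster X) : h.s (A ⊔ B) = h.s A ⊔ h.s B := by rw [← ofPair_eq_sup h, s_ofPair]

@[simp]
theorem q_sup (A B : F.Cluster X) : h.q (A ⊔ B) = h.q A ⊔ h.q B := by rw [← ofPair_eq_sup h, q_ofPair]

omit [F.IsOrean] in
theorem sinv_inf_kerSub (f : X ⟶ Y) (T : F.Cluster Y) :
    sinv f (h.s T) ⊓ kerSub (qinv f (h.q T)) = sinv f (h.s T) := by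
  rw [kerSub_qinv, inf_eq_left]
  exact (sgc S f).monotone_u (h.adm T).1

@[simp]
theorem s_inv (f : X ⟶ Y) (T : F.Cluster Y) : h.s (F.inv f T) = sinv f (h.s T) := by
  rw [← ofPairLE_eq_inv h, ofPairLE, s_ofPair, sinv_inf_kerSub]

@[simp]
theorem q_inv (f : X ⟶ Y) (T : F.Cluster Y) :
    h.q (F.inv f T) = coreflect (sinv f (h.s T)) (qinv f (h.q T)) := by
  rw [← ofPairLE_eq_inv h, ofPairLE, q_ofPair, sinv_inf_kerSub]

@[simp]
theorem s_top : h.s (⊤ : F.Cluster X) = ⊤ :=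
  top_unique (by simpa using (h.le_iff.1 (le_top : h.ofPair .top ≤ _)).1)

@[simp]
theorem q_top : h.q (⊤ : F.Cluster X) = ⊤ :=
  top_unique (by simpa using (h.le_iff.1 (le_top : h.ofPair .top ≤ _)).2)

@[simp]
theorem s_bot : h.s (⊥ : F.Cluster X) = ⊥ :=
  bot_unique (by simpa using (h.le_iff.1 (bot_le : _ ≤ h.ofPair .bot)).1)

@[simp]
theorem q_bot : h.q (⊥ : F.Cluster X) = ⊥ :=
  bot_unique (by simpa using (h.le_iff.1 (bot_le : _ ≤ h.ofPair .bot)).2)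

/-- The conormal cluster of a subobject. -/
noncomputable def ofSub (A : S.Subobjects X) : F.Cluster X := h.ofPair (.coreflect_top A)

/-- The normal cluster of a quotient. -/
noncomputable def ofQuo (E : S.Quotients X) : F.Cluster X := h.ofPair (.kerSub E)

/-- On an admissible pair the second component of `ofSub A` imposes nothing beyond the bound on the
subobject, so only the subobject is cut down. -/
theorem inf_ofSub (T : F.Cluster X) (A : S.Subobjects X) :
    T ⊓ h.ofSub A = h.ofPair (A := h.s T ⊓ A) (.of_le_kerSub (inf_le_left.trans (h.adm T).1)) := by
  refine eq_of_forall_le_iff fun D => ?_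
  rw [le_inf_iff, h.le_iff, h.le_iff, h.le_iff, ofSub, s_ofPair, s_ofPair, q_ofPair, q_ofPair]
  constructor
  · rintro ⟨⟨h₁, h₂⟩, h₃, -⟩
    exact ⟨le_inf h₁ h₃, (h.adm D).2.trans (coreflect_mono (le_inf h₁ h₃) h₂)⟩
  · rintro ⟨h₁, h₂⟩
    exact ⟨⟨h₁.trans inf_le_left, h₂.trans (coreflect_le _ _)⟩, h₁.trans inf_le_right,
      h₂.trans (coreflect_mono inf_le_right le_top)⟩

variable {W : C} {e : X ⟶ W} {m : W ⟶ Y}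

theorem im_comp_eq (he : S.right e) (hm : S.left m) : F.im (e ≫ m) = h.ofSub (sub m hm) := by
  have h₁ : qdir e (⊤ : S.Quotients X) = ⊤ := by
    rw [← (qgc S e).u_top, qdir_qinv_of_right he]
  refine h.ext ?_ ?_
  · rw [im, s_dir, s_top, sdir_comp, sdir_top_of_right he, sdir_top_of_left hm, ofSub, s_ofPair]
  · rw [im, q_dir, q_top, qdir_comp, h₁, ofSub, q_ofPair, coreflect_sub, (qgc S m).u_top]

theorem ker_comp_eq (he : S.right e) (hm : S.left m) : F.ker (e ≫ m) = h.ofQuo (quo e he) := by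
  refine h.ext ?_ ?_
  · rw [ker, s_inv, s_bot, ofQuo, s_ofPair, sinv_bot hm, kerSub_quo]
  · rw [ker, q_inv, q_bot, s_bot, sinv_bot hm, qinv_bot he hm, ofQuo, q_ofPair, ← kerSub_quo he,
      coreflect_kerSub]

theorem im_of_left (hm : S.left m) : F.im m = h.ofSub (sub m hm) := by
  rw [← h.im_comp_eq right_id hm, Category.id_comp]

theorem ker_of_right (he : S.right e) : F.ker e = h.ofQuo (quo e he) := by
  rw [← h.ker_comp_eq he left_id, Category.comp_id]

theorem im_eq_ofSub (f : X ⟶ Y) : F.im f = h.ofSub (h.s (F.im f)) := by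
  obtain ⟨W, e, m, he, hm, rfl⟩ := (pfs S).factorization f
  rw [h.im_comp_eq he hm]
  simp [ofSub]

theorem ker_eq_ofQuo (f : X ⟶ Y) : F.ker f = h.ofQuo (h.q (F.ker f)) := by
  obtain ⟨W, e, m, he, hm, rfl⟩ := (pfs S).factorization f
  rw [h.ker_comp_eq he hm]
  simp [ofQuo]

theorem conormalCluster_ofSub (A : S.Subobjects X) : F.ConormalCluster (h.ofSub A) := by
  obtain ⟨W, m, hm, rfl⟩ := exists_sub_eq A
  exact ⟨W, m, h.im_of_left hm⟩

theorem normalCluster_ofQuo (E : S.Quotients X) : F.NormalCluster (h.ofQuo E) := by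
  obtain ⟨W, e, he, rfl⟩ := exists_quo_eq E
  exact ⟨W, e, h.ker_of_right he⟩

theorem conormalCluster_iff {A : F.Cluster X} : F.ConormalCluster A ↔ h.ofSub (h.s A) = A := by
  refine ⟨?_, fun hA => hA ▸ h.conormalCluster_ofSub _⟩
  rintro ⟨W, f, rfl⟩
  exact (h.im_eq_ofSub f).symm

theorem normalCluster_iff {A : F.Cluster X} : F.NormalCluster A ↔ h.ofQuo (h.q A) = A := by
  refine ⟨?_, fun hA => hA ▸ h.normalCluster_ofQuo _⟩
  rintro ⟨W, f, rfl⟩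
  exact (h.ker_eq_ofQuo f).symm

include h

/-- The noetherian identities are checked for left and right morphisms separately, then combined
along factorizations. -/
theorem inv_dir_of_left (hm : S.left m) (A : F.Cluster W) : F.inv m (F.dir m A) = A := by
  refine h.ext ?_ ?_
  · rw [s_inv, s_dir, sinv_sdir_of_left hm]
  · rw [q_inv, s_dir, q_dir, sinv_sdir_of_left hm, (h.adm A).coreflect_qinv_qdir hm]

theorem inv_dir_of_right (he : S.right e) (A : F.Cluster X) : F.inv e (F.dir e A) = A ⊔ F.ker e := by
  have h₁ := h.ker_of_right he
  refine h.ext ?_ ?_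
  · rw [s_inv, s_dir, sinv_sdir_of_right he, s_sup, h₁, ofQuo, s_ofPair, kerSub_quo]
  · rw [q_inv, s_dir, q_dir, sinv_sdir_of_right he, qinv_qdir_of_right he, q_sup, h₁, ofQuo, q_ofPair,
      ← kerSub_quo he, ((h.adm A).sup (.kerSub _)).coreflect_eq]

theorem dir_inv_of_right (he : S.right e) (T : F.Cluster W) : F.dir e (F.inv e T) = T := by
  refine h.ext ?_ ?_
  · rw [s_dir, s_inv, sdir_sinv_of_right he]
  · rw [q_dir, q_inv, qdir_coreflect_of_right he, (h.adm T).coreflect_eq]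

theorem dir_inv_of_left (hm : S.left m) (T : F.Cluster Y) : F.dir m (F.inv m T) = T ⊓ F.im m := by
  rw [h.im_of_left hm, h.inf_ofSub]
  refine h.ext ?_ ?_
  · rw [s_dir, s_inv, sdir_sinv_of_left hm, s_ofPair]
  · rw [q_dir, q_inv, qdir_coreflect_of_left hm, q_ofPair]

theorem isQuotientOf (he : S.right e) : F.IsQuotientOf e (F.ker e) := by
  refine ⟨rfl, fun V g hg => ?_⟩
  obtain ⟨U, e', m', he', hm', rfl⟩ := (pfs S).factorization g
  rw [h.ker_of_right he, h.ker_comp_eq he' hm', h.le_iff, ofQuo, ofQuo, q_ofPair, q_ofPair] at hg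
  obtain ⟨w, rfl⟩ := quo_le_quo.1 hg.2
  have := (pfs S).epi_of_right e he
  exact ⟨w ≫ m', by simp, fun w' hw' => by
    rw [← cancel_epi e]
    simpa using hw'⟩

theorem isEmbeddingOf (hm : S.left m) : F.IsEmbeddingOf m (F.im m) := by
  refine ⟨rfl, fun V g hg => ?_⟩
  obtain ⟨U, e', m', he', hm', rfl⟩ := (pfs S).factorization g
  rw [h.im_of_left hm, h.im_comp_eq he' hm', h.le_iff, ofSub, ofSub, s_ofPair, s_ofPair] at hg
  obtain ⟨w, rfl⟩ := sub_le_sub.1 hg.1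
  have := (pfs S).mono_of_left m hm
  exact ⟨e' ≫ w, by simp, fun w' hw' => by simpa [← Category.assoc, cancel_mono] using hw'⟩

end Orean

include h

theorem isNoetherian : F.IsNoetherian where
  toIsOrean := h.isOrean
  inv_dir f A := by
    have := h.isOrean
    obtain ⟨W, e, m, he, hm, rfl⟩ := (pfs S).factorization f
    rw [dir_comp, inv_comp, h.inv_dir_of_left hm, h.inv_dir_of_right he, h.ker_of_right he,
      h.ker_comp_eq he hm]
  dir_inv f A := by
    have := h.isOrean
    obtain ⟨W, e, m, he, hm, rfl⟩ := (pfs S).factorization f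
    rw [dir_comp, inv_comp, h.dir_inv_of_right he, h.dir_inv_of_left hm, h.im_of_left hm,
      h.im_comp_eq he hm]
  factorization f := by
    have := h.isOrean
    obtain ⟨W, e, m, he, hm, rfl⟩ := (pfs S).factorization f
    refine ⟨W, e, m, ?_, ?_, rfl⟩
    · rw [h.ker_comp_eq he hm, ← h.ker_of_right he]
      exact h.isQuotientOf he
    · rw [h.im_comp_eq he hm, ← h.im_of_left hm]
      exact h.isEmbeddingOf hm
  normal_sup A B hA hB := by
    have := h.isOrean
    rw [h.normalCluster_iff] at *
    rw [← hA, ← hB]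
    refine h.ext ?_ ?_
    -- Normality of the join is decided by its subobject component, where (B5) enters.
    · simp [ofQuo, kerSub_sup]
    · simp [ofQuo]
  conormal_inf A B hA hB := by
    have := h.isOrean
    rw [h.conormalCluster_iff] at *
    rw [← hA, ← hB, h.inf_ofSub]
    refine h.ext ?_ ?_
    · simp [ofSub]
    · simp [ofSub, coreflect_coreflect]

/-- Keeping one component of an admissible pair and taking the largest admissible choice of the
other gives the two closures; their meet returns the pair. -/
theorem exists_isClosurePair [F.IsOrean] : ∃ κs κe : Operator F F, IsClosurePair κs κe := by
  let κs : Operator F F := operatorOfClusters (fun X A => h.ofSub (h.s A)) (by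
    intro X Y f A B r
    rw [h.rel_iff] at r ⊢
    simp only [ofSub, s_ofPair, q_ofPair]
    exact ⟨r.1, (qdir_coreflect_top_le f _).trans (coreflect_mono r.1 le_rfl)⟩)
  let κe : Operator F F := operatorOfClusters (fun X A => h.ofQuo (h.q A)) (by
    intro X Y f A B r
    rw [h.rel_iff] at r ⊢
    simp only [ofQuo, s_ofPair, q_ofPair]
    exact ⟨(sdir_kerSub_le f _).trans (kerSub_mono r.2), r.2⟩)
  have hs : ∀ {X : C} (A : F.Cluster X), κs.app A = h.ofSub (h.s A) :=
    fun A => operatorOfClusters_app _ _ A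
  have he : ∀ {X : C} (A : F.Cluster X), κe.app A = h.ofQuo (h.q A) :=
    fun A => operatorOfClusters_app _ _ A
  refine ⟨κs, κe, ⟨Operator.isIdempotent_of_app fun A => ?_, fun A => ?_⟩,
    ⟨Operator.isIdempotent_of_app fun A => ?_, fun A => ?_⟩, fun {X A} => ?_, fun {X A} => ?_,
    fun A => ?_, fun f => ?_⟩
  · simp [hs, ofSub]
  · rw [hs, h.le_iff, ofSub, s_ofPair, q_ofPair]
    exact ⟨le_rfl, (h.adm A).2.trans (coreflect_mono le_rfl le_top)⟩
  · simp [he, ofQuo]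
  · rw [he, h.le_iff, ofQuo, s_ofPair, q_ofPair]
    exact ⟨(h.adm A).1, le_rfl⟩
  · rw [hs, h.conormalCluster_iff]
  · rw [he, h.normalCluster_iff]
  · rw [hs, he, inf_comm, h.inf_ofSub, h.le_iff, s_ofPair, q_ofPair, ofQuo, q_ofPair]
    exact ⟨inf_le_right, coreflect_le _ _⟩
  · rw [hs, hs]
    refine h.ext ?_ ?_
    · simp [ofSub, ker]
    · simp [ofSub, ker, coreflect_sinv_qinv_top]

theorem isEmdNoetherian : IsEmdNoetherian F where
  toIsNoetherian := h.isNoetherian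
  exists_decomposition := by
    have := h.isNoetherian
    obtain ⟨κs, κe, hκ⟩ := h.exists_isClosurePair
    exact ⟨κs, κe, hκ.isExactMeetDecomposition⟩

/-- An image `⊤` forces the left part of the factorization to be invertible, and a kernel `⊥` forces
the right part to be. -/
theorem bicategoryStructure_eq [F.IsNoetherian] : F.bicategoryStructure = S := by
  have hr : F.bicategoryStructure.right = S.right := by
    ext X Y f
    rw [bicategoryStructure_right_iff]
    constructor
    · obtain ⟨W, e, m, he, hm, rfl⟩ := (pfs S).factorization f
      intro hf
      rw [h.im_comp_eq he hm] at hf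
      have h₁ := congrArg h.s hf
      rw [ofSub, s_ofPair, s_top] at h₁
      have := isIso_of_sub_eq_top h₁
      exact (pfs S).right_comp _ _ he ((pfs S).right_of_isIso m)
    · intro hf
      rw [← Category.comp_id f, h.im_comp_eq hf left_id, ← im_id, h.im_of_left left_id]
  have hl : F.bicategoryStructure.left = S.left := by
    ext X Y f
    rw [bicategoryStructure_left_iff]
    constructor
    · obtain ⟨W, e, m, he, hm, rfl⟩ := (pfs S).factorization f
      intro hf
      rw [h.ker_comp_eq he hm] at hf
      have h₁ := congrArg h.q hf
      rw [ofQuo, q_ofPair, q_bot] at h₁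
      have := isIso_of_quo_eq_bot h₁
      exact (pfs S).left_comp _ _ ((pfs S).left_of_isIso e) hm
    · intro hf
      rw [← Category.id_comp f, h.ker_comp_eq right_id hf, ← ker_id, h.ker_of_right right_id]
  generalize F.bicategoryStructure = T at hr hl
  cases T
  cases S
  subst hr hl
  rfl

end PairPresentation

end FormTheory

/-! ### The bijection -/

namespace FormTheory

open Form BicategoryStructure

variable {C : Type u} [Category.{v} C]

theorem Operator.rel_app_iff_of_comp_eq_id {F G : Form C} {τ : Operator F G} {σ : Operator G F}
    (h : τ.functor ⋙ σ.functor = 𝟭 _) {X Y : C} {f : X ⟶ Y} {A : F.Cluster X} {B : F.Cluster Y} :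
    G.Rel f (τ.app A) (τ.app B) ↔ F.Rel f A B := by
  have h₁ : ∀ {X : C} (A : F.Cluster X), σ.app (τ.app A) = A := fun A =>
    Subtype.ext (Functor.congr_obj h A.1)
  refine ⟨fun r => ?_, τ.rel_app⟩
  rw [← h₁ A, ← h₁ B]
  exact σ.rel_app r

theorem Presents.of_isIsomorphic {S : BicategoryStructure C} {F G : Form C} (hF : Presents S F)
    (h : F.IsIsomorphic G) : Nonempty (Presents S G) := by
  obtain ⟨φ, ψ, h₁, h₂, h₃⟩ := h
  have h₄ : ψ ⋙ F.proj = G.proj := by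
    rw [← h₃, ← Functor.assoc, h₂, Functor.id_comp]
  let τ : Operator F G := ⟨φ, h₃⟩
  let σ : Operator G F := ⟨ψ, h₄⟩
  refine ⟨⟨fun p hp => τ.app (hF.cl p hp), fun f p hp q hq => ?_, fun {X} A => ?_⟩⟩
  · rw [Operator.rel_app_iff_of_comp_eq_id (σ := σ) h₁, hF.rel_iff]
  · obtain ⟨p, hp, hA⟩ := hF.exists_cl_eq (σ.app A)
    refine ⟨p, hp, ?_⟩
    rw [hA]
    exact Subtype.ext (Functor.congr_obj h₂ A.1)

/-- The pushout `n` is left by (B3), and since `⊥ = ⊤` in `Y` its image is the direct image of `⊥`,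
which is `⊥`. -/
theorem BicategoryStructure.isInitialLeft_of_isPushout {S : BicategoryStructure C} [Fact S.Axioms]
    {X Y Z P : C} {e : X ⟶ Y} {m : X ⟶ Z} {n : Y ⟶ P} {e' : Z ⟶ P} (he : S.right e)
    (hm : S.left m) (hY : S.LeftTrivial Y) (sq : IsPushout e m n e') : S.IsInitialLeft n := by
  have hn := left_of_isPushout he hm hY sq
  rw [isInitialLeft_iff hn, ← sdir_top_of_left, ← leftTrivial_iff.1 hY, (sgc S n).l_bot]

/-- The subform of subquotients whose pushout is initial left presents the structure. -/
noncomputable def emdSubformPresents (S : BicategoryStructure C) [Fact S.Axioms] :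
    Presents S S.emdSubform where
  cl {X} p hp := ⟨⟨⟨X, Quotient.mk _ p⟩, p, rfl, by
    obtain ⟨P, n, e', -, sq⟩ := exists_isPushout p.right_e p.m
    exact ⟨P, n, e', sq, isInitialLeft_of_isPushout p.right_e p.left_m hp sq⟩⟩, rfl⟩
  rel_iff {X Y} f p hp q hq := by
    constructor
    · rintro ⟨φ, hφ⟩
      have h₁ : φ.hom.hom = f := by
        refine Eq.trans hφ ?_
        erw [eqToHom_refl, eqToHom_refl, Category.id_comp, Category.comp_id]
      exact h₁ ▸ φ.hom.rel
    · intro r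
      refine ⟨⟨⟨f, r⟩⟩, ?_⟩
      erw [eqToHom_refl, eqToHom_refl, Category.id_comp, Category.comp_id]
      rfl
  exists_cl_eq {X} A := by
    obtain ⟨⟨⟨Y, c⟩, p, hp, P, n, e', sq, hn⟩, rfl⟩ := A
    have h₁ : (⟨Y, Quotient.mk _ p⟩ : S.subquotientSystem.Obj) = ⟨Y, c⟩ :=
      congrArg (ClusterSystem.Obj.mk (K := S.subquotientSystem) Y) hp
    -- The initial left pushout `n` itself witnesses that the codomain of `p.e` is left trivial.
    exact ⟨p, ⟨P, n, hn⟩, Subtype.ext (ObjectProperty.FullSubcategory.ext h₁)⟩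

theorem isEmdNoetherian_emdSubform {S : BicategoryStructure C} (hS : S.Axioms) :
    IsEmdNoetherian S.emdSubform := by
  have : Fact S.Axioms := ⟨hS⟩
  obtain ⟨h⟩ := (emdSubformPresents S).nonempty_pairPresentation
  exact h.isEmdNoetherian

theorem Presents.bicategoryStructure_eq {S : BicategoryStructure C} (hS : S.Axioms) {F : Form C}
    [F.IsNoetherian] (hF : Presents S F) : F.bicategoryStructure = S := by
  have : Fact S.Axioms := ⟨hS⟩
  obtain ⟨h⟩ := hF.nonempty_pairPresentation
  exact h.bicategoryStructure_eq

theorem IsEmdNoetherian.axioms_and_presents (F : Form C) [IsEmdNoetherian F] :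
    F.bicategoryStructure.Axioms ∧ Nonempty (Presents F.bicategoryStructure F) := by
  obtain ⟨κs, κe, h⟩ := IsEmdNoetherian.exists_decomposition (F := F)
  exact ⟨h.isClosurePair.axioms, ⟨h.isClosurePair.presents⟩⟩

/-- The correspondence between emd-noetherian forms and bicategory structures. -/
noncomputable def emdFormEquiv (C : Type u) [Category.{v} C] :
    Quotient (EmdForm.setoid C) ≃ {S : BicategoryStructure C // S.Axioms} where
  toFun := Quotient.lift (fun F : EmdForm C => ⟨F.form.bicategoryStructure,
      (IsEmdNoetherian.axioms_and_presents F.form).1⟩) (fun F G h => by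
    obtain ⟨hF, ⟨pF⟩⟩ := IsEmdNoetherian.axioms_and_presents F.form
    obtain ⟨pG⟩ := pF.of_isIsomorphic h
    -- The form `G` is presented by the structure of `F`, and a presented form has the presenting
    -- structure as its own.
    exact Subtype.ext (pG.bicategoryStructure_eq hF).symm)
  invFun S := Quotient.mk _ (@EmdForm.mk C _ S.1.emdSubform (isEmdNoetherian_emdSubform S.2))
  left_inv := by
    rintro ⟨F⟩
    obtain ⟨hF, ⟨pF⟩⟩ := IsEmdNoetherian.axioms_and_presents F.form
    have : Fact F.form.bicategoryStructure.Axioms := ⟨hF⟩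
    exact Quotient.sound ((emdSubformPresents _).isIsomorphic pF)
  right_inv := by
    rintro ⟨S, hS⟩
    have : Fact S.Axioms := ⟨hS⟩
    have := isEmdNoetherian_emdSubform hS
    exact Subtype.ext ((emdSubformPresents S).bicategoryStructure_eq hS)

end FormTheory

theorem mainTheorem3 (C : Type u) [Category.{v} C] :
    ∃ Φ : Quotient (EmdForm.setoid C) ≃ {S : BicategoryStructure C // S.Axioms},
      (∀ F : EmdForm C,
        (Φ (Quotient.mk _ F)).1.right = F.form.quotients ∧
        (Φ (Quotient.mk _ F)).1.left = F.form.embeddings) ∧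
      (∀ S : {S : BicategoryStructure C // S.Axioms},
        ∃ h : IsEmdNoetherian S.1.emdSubform,
          Φ (Quotient.mk _ (@EmdForm.mk C _ S.1.emdSubform h)) = S) :=
  ⟨emdFormEquiv C, fun _ => ⟨rfl, rfl⟩, fun S =>
    ⟨isEmdNoetherian_emdSubform S.2, (emdFormEquiv C).right_inv S⟩⟩
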